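/- **Setting.** Identify $\mathbb R^2$ with $\mathbb C$. A configuration of a planar 3-RPR bar-plate framework consists of base points $\mathbf x_1,\mathbf x_2,\mathbf x_3$ and platform points $\mathbf x_4,\mathbf x_5,\mathbf x_6$ in $\mathbb R^2$; leg $i$ joins $\mathbf x_i$ to $\mathbf x_{i+3}$, and the base triangle and the platform triangle are rigid plates. Write $\mathbf x_k=(a_k,b_k)$. The combinatorial structure is intact if no leg has length zero and no two legs coincide (same base point and same platform point). The configuration is non-degenerate if the three base points do not all coincide and the three platform points do not all coincide. *Flexion order.* A pose of the platform is given by $q=(q_0,q_1,q_2,q_3)$ with $c_0:=q_0^2+q_1^2-1=0$ (Blaschke–Grünwald parameters); it acts by $$(a,b)\mapsto \tfrac{1}{q_0^2+q_1^2}\bigl((q_0^2-q_1^2)a-2q_0q_1b+2q_1q_2+2q_0q_3,\ 2q_0q_1a+(q_0^2-q_1^2)b+2q_1q_3-2q_0q_2\bigr).$$ For a configuration, let $r_i=\|\mathbf x_i-\mathbf x_{i+3}\|$ and let $c_i$ ($i=1,2,3$, $j=i+3$) be the quadratic polynomial $$\begin{aligned}c_i={}&2a_ia_j(q_1^2-q_0^2)+2b_ib_j(q_1^2-q_0^2)+4a_ib_jq_0q_1-4b_ia_jq_0q_1+(a_j^2+b_j^2)(q_0^2+q_1^2)\\&-4a_i(q_0q_3+q_1q_2)+4b_i(q_0q_2-q_1q_3)+4a_j(q_0q_3-q_1q_2)-4b_j(q_0q_2+q_1q_3)\\&+a_i^2+b_i^2+4(q_2^2+q_3^2)-r_i^2,\end{aligned}$$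 which on $c_0=0$ expresses that the moved point $\mathbf x_j$ has distance $r_i$ from $\mathbf x_i$. The given configuration is the solution $(1,0,0,0)$ of $c_0=c_1=c_2=c_3=0$. Its flexion order is $c-1$, where $c$ is the multiplicity over $\mathbb C$ of this solution (the length of the local ring there); it is $\infty$ if the solution is not isolated, i.e. if the configuration belongs to a continuous flexion over $\mathbb C$. Let $s=\det(\nabla c_0,\nabla c_1,\nabla c_2,\nabla c_3)$ and let $V_1$ be its zero set; the configuration corresponds to a singular point of $V_1$ if $s=0$ and $\nabla s=0$ at $(1,0,0,0)$. *Averaging and Set A.* Let $\mathbf X,\mathbf X'$ be two incongruent realisations (no direct or indirect isometry maps $\mathbf X$ to $\mathbf X'$) of the same non-degenerate framework (same base plate, platform plate and leg lengths), both with intact combinatorial structure, and suppose that there are direct isometries $\alpha,\beta$ of $\mathbb R^2$ with $\alpha(\mathbf x_i)=\mathbf x_i'$ for $i=1,2,3$ and $\beta(\mathbf x_j)=\mathbf x'_j$ for $j=4,5,6$ (Set A). Let $\overline{\mathbf X}$ be the configuration of the midpoints $\tfrac12(\mathbf x_k+\mathbf x'_k)$, and assume that its combinatorial structure is intact. *Normal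 forms.* All parameters are real and $(f_0,f_1)\ne(0,0)$. Given platform points $\mathbf p_j$, $\mathbf p_j'$ ($j=4,5,6$) and base points $\mathbf y_i$ ($i=1,2,3$), we say that the pair $(\mathbf X,\mathbf X')$ has this normal form with relative orientation $(f_0:f_1)$ if, after relabelling the legs, applying to both realisations the same orientation-preserving similarity, and translating the two realisations independently, $\mathbf X'$ has base points $\mathbf y_i$ and platform points $\mathbf p'_j$, while $\mathbf X$ is obtained from the configuration with base points $\mathbf y_i$ and platform points $\mathbf p_j$ by the rotation with parameters $(f_0:f_1:0:0)$. A base point on a bisector, with parameter $l_i$, means $$\mathbf y_i=\tfrac12(\mathbf p_{i+3}+\mathbf p'_{i+3})+l_i\,\mathbf n_i,\qquad \mathbf n_i=(b-b',\,a'-a)\ \text{ for }\ \mathbf p_{i+3}=(a,b),\ \mathbf p'_{i+3}=(a',b').$$ - Case ($I_i$): $\mathbf p_4=(0,1)$, $\mathbf p_5=(a_5,b_5)$, $\mathbf p_6=(a_6,b_6)$; $\mathbf p_j'$ is the image of $\mathbf p_j$ under the rotation $(e_0:e_1:0:0)$ with $e_1\neq0$; $\mathbf p_5\ne\mathbf p_5'$,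 $\mathbf p_6\neq\mathbf p_6'$; all $\mathbf y_i$ on bisectors with parameters $l_1,l_2,l_3$. - Case ($I_{ii}$): as in ($I_i$), but $\mathbf p_6=(0,0)$ (so $\mathbf p_6=\mathbf p_6'$), $\mathbf p_5\ne\mathbf p'_5$, $\mathbf y_1,\mathbf y_2$ on bisectors with parameters $l_1,l_2$, and $\mathbf y_3=(a_3,b_3)$ arbitrary. - Case ($I_{iii}$): as in ($I_i$), but $\mathbf p_5=\mathbf p_6=(0,0)$, $\mathbf y_1$ on a bisector with parameter $l_1$, and $\mathbf y_2=(a_2,b_2)$, $\mathbf y_3=(a_3,b_3)$ arbitrary. - Case ($II$): $\mathbf p_4=(0,0)$, $\mathbf p_5=(a_5,b_5)$, $\mathbf p_6=(a_6,b_6)$; $\mathbf p'_j=\mathbf p_j+(1,0)$; all $\mathbf y_i$ on bisectors with parameters $l_1,l_2,l_3$. **Theorem.** Under these assumptions $\overline{\mathbf X}$ has flexion order at least $1$, and the pair $(\mathbf X,\mathbf X')$ has a normal form of at least one of the four cases. If $\overline{\mathbf X}$ does not correspond to a singular point of $V_1$, then for every normal form of the pair, $\overline{\mathbf X}$ has flexion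 order at least $2$ if and only if the following polynomial vanishes: - Case ($I_i$): $f_0(f_0e_0+f_1e_1)P_{I_i}$; - Case ($I_{ii}$): $f_0(f_0e_0+f_1e_1)P_{I_{ii}}$; - Case ($I_{iii}$): $f_0(e_0f_0+e_1f_1)(a_2b_3-a_3b_2)(e_0-2e_1l_1)$; - Case ($II$): $f_0P_{II}$, where $$\begin{aligned} P_{I_i}={}&(e_0-2e_1l_2)a_6(a_5^2+b_5^2)(f_1+2l_1f_0)(f_1+2l_3f_0)\\&-(e_0-2e_1l_3)a_5(a_6^2+b_6^2)(f_1+2l_1f_0)(f_1+2l_2f_0)\\&+(e_0-2e_1l_1)(a_5b_6-a_6b_5)(f_1+2l_2f_0)(f_1+2l_3f_0),\\ P_{I_{ii}}={}&(e_0-2e_1l_2)(a_5^2+b_5^2)(a_3e_0+b_3e_1)(f_1+2f_0l_1)\\&-(e_0-2e_1l_1)\bigl[(a_3b_5-a_5b_3)e_0+(a_3a_5+b_3b_5)e_1\bigr](f_1+2f_0l_2),\\ P_{II}={}&a_5(l_1-l_3)(f_1+2f_0l_2)-a_6(l_1-l_2)(f_1+2f_0l_3). \end{aligned}$$ -/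

import Mathlib

noncomputable section

namespace RPR

/-! The Euclidean plane is identified with `ℂ`: the point with coordinates `(a, b)` is `a + b i`. -/

/-- A configuration of a planar 3-RPR bar-plate framework: `base i` is the base anchor point and
`platform i` the platform anchor point of the `i`-th leg (so that `base` lists `x₁, x₂, x₃` and
`platform` lists `x₄, x₅, x₆`). -/
structure Config where
  base : Fin 3 → ℂ
  platform : Fin 3 → ℂ

/-- Neither the three base points nor the three platform points collapse to a single point. -/
def Config.NonDegenerate (X : Config) : Prop :=
  (∃ i j, X.base i ≠ X.base j) ∧ (∃ i j, X.platform i ≠ X.platform j)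

/-- The combinatorial structure of the bar-plate framework is intact: no leg has length zero, and
no two legs coincide. -/
def Config.ProperLegs (X : Config) : Prop :=
  (∀ i, X.base i ≠ X.platform i) ∧
    ∀ i j, i ≠ j → ¬ (X.base i = X.base j ∧ X.platform i = X.platform j)

/-- `X` and `X'` are realisations of the same bar-plate framework: the same base plate, the same
platform plate, the same leg lengths. -/
def SameMetric (X X' : Config) : Prop :=
  (∀ i j, dist (X.base i) (X.base j) = dist (X'.base i) (X'.base j)) ∧
    (∀ i j, dist (X.platform i) (X.platform j) = dist (X'.platform i) (X'.platform j)) ∧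
    ∀ i, dist (X.base i) (X.platform i) = dist (X'.base i) (X'.platform i)

/-- No isometry of the plane, direct or indirect, maps `X` to `X'`. -/
def Incongruent (X X' : Config) : Prop :=
  ¬ ∃ g : ℂ ≃ᵢ ℂ, (∀ i, g (X.base i) = X'.base i) ∧ ∀ i, g (X.platform i) = X'.platform i

/-- Direct (orientation preserving) isometries of the plane. -/
def IsDirectIsometry (g : ℂ → ℂ) : Prop :=
  ∃ u v : ℂ, ‖u‖ = 1 ∧ ∀ z, g z = u * z + v

/-- Set A: the bases, and likewise the platforms, correspond under a direct isometry. -/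
def SetA (X X' : Config) : Prop :=
  (∃ g, IsDirectIsometry g ∧ ∀ i, g (X.base i) = X'.base i) ∧
    ∃ g, IsDirectIsometry g ∧ ∀ i, g (X.platform i) = X'.platform i

/-- The configuration of the midpoints of corresponding vertices. -/
def average (X X' : Config) : Config where
  base i := (X.base i + X'.base i) / 2
  platform i := (X.platform i + X'.platform i) / 2

/-! ### The direct kinematic problem and the flexion order -/

open MvPolynomial in
/-- The normalising condition `c₀` in the variables `q₀, q₁, q₂, q₃`. -/
def normalisation : MvPolynomial (Fin 4) ℂ := X 0 ^ 2 + X 1 ^ 2 - 1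

open MvPolynomial in
/-- The condition that the platform point `(a', b')`, moved by the pose `q`, has distance `r` from
the base point `(a, b)`. -/
def legConstraint (a b a' b' r : ℝ) : MvPolynomial (Fin 4) ℂ :=
  let k : ℝ → MvPolynomial (Fin 4) ℂ := fun x => C (x : ℂ)
  let q : Fin 4 → MvPolynomial (Fin 4) ℂ := X
  2 * k a * k a' * q 1 ^ 2 - 2 * k a * k a' * q 0 ^ 2 + 4 * k a * k b' * q 0 * q 1
    - 4 * k b * k a' * q 0 * q 1 - 2 * k b * k b' * q 0 ^ 2 + 2 * k b * k b' * q 1 ^ 2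
    + (k a' ^ 2 + k b' ^ 2) * (q 0 ^ 2 + q 1 ^ 2)
    - 4 * k a * (q 0 * q 3 + q 1 * q 2) + 4 * k b * (q 0 * q 2 - q 1 * q 3)
    + 4 * k a' * (q 0 * q 3 - q 1 * q 2) - 4 * k b' * (q 0 * q 2 + q 1 * q 3)
    + k a ^ 2 + k b ^ 2 + 4 * (q 2 ^ 2 + q 3 ^ 2) - k r ^ 2

/-- The system `c₀, c₁, c₂, c₃` whose zeros are the realisations of the framework that has the
base, the platform and the leg lengths of `Y`. The moving frame is chosen to agree with the fixed
frame at `Y`, so that `Y` itself is the solution `(1, 0, 0, 0)`. -/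
def constraints (Y : Config) : Fin 4 → MvPolynomial (Fin 4) ℂ :=
  Fin.cons normalisation fun i =>
    legConstraint (Y.base i).re (Y.base i).im (Y.platform i).re (Y.platform i).im
      (dist (Y.base i) (Y.platform i))

/-- The point `(1, 0, 0, 0)`, that is, the identity pose. -/
def idPose : Fin 4 → ℂ := ![1, 0, 0, 0]

/-- The (maximal) ideal of the polynomials vanishing at `p`. -/
abbrev idealAt (p : Fin 4 → ℂ) : Ideal (MvPolynomial (Fin 4) ℂ) :=
  RingHom.ker (MvPolynomial.eval p)

instance (p : Fin 4 → ℂ) : (idealAt p).IsPrime :=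
  RingHom.ker_isPrime (MvPolynomial.eval p)

/-- The multiplicity of `p` as a solution over `ℂ` of the system `c`: the length of the local ring
of the scheme `c = 0` at `p`. It is infinite iff `p` is not an isolated solution. -/
def solutionMultiplicity (c : Fin 4 → MvPolynomial (Fin 4) ℂ) (p : Fin 4 → ℂ) : ℕ∞ :=
  Module.length (Localization.AtPrime (idealAt p))
    (Localization.AtPrime (idealAt p) ⧸
      (Ideal.span (Set.range c)).map
        (algebraMap (MvPolynomial (Fin 4) ℂ) (Localization.AtPrime (idealAt p))))

/-- The flexion order of a configuration: the number of realisations over `ℂ` coinciding with it,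
minus one. It is `⊤` iff the configuration belongs to a continuous flexion over `ℂ`. -/
def flexionOrder (Y : Config) : ℕ∞ := solutionMultiplicity (constraints Y) idPose - 1

/-- The determinant `s` of the rigidity matrix `(∇c₀, ∇c₁, ∇c₂, ∇c₃)`. The hypersurface `V₁` is
its zero set. -/
def rigidityDet (Y : Config) : MvPolynomial (Fin 4) ℂ :=
  Matrix.det (Matrix.of fun i j => MvPolynomial.pderiv i (constraints Y j))

/-- `Y` corresponds to a singular point of `V₁`: `s` and `∇s` vanish at the identity pose. -/
def IsSingularV1 (Y : Config) : Prop :=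
  MvPolynomial.eval idPose (rigidityDet Y) = 0 ∧
    ∀ i, MvPolynomial.eval idPose (MvPolynomial.pderiv i (rigidityDet Y)) = 0

/-! ### The parametrisation of Set A -/

/-- The direct isometry with Blaschke–Grünwald parameters `(q₀ : q₁ : q₂ : q₃)`, where
`(q₀, q₁) ≠ (0, 0)`. -/
def bgMap (q₀ q₁ q₂ q₃ : ℝ) (z : ℂ) : ℂ :=
  ⟨((q₀ ^ 2 - q₁ ^ 2) * z.re - 2 * q₀ * q₁ * z.im + (2 * q₁ * q₂ + 2 * q₀ * q₃))
      / (q₀ ^ 2 + q₁ ^ 2),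
    (2 * q₀ * q₁ * z.re + (q₀ ^ 2 - q₁ ^ 2) * z.im + (2 * q₁ * q₃ - 2 * q₀ * q₂))
      / (q₀ ^ 2 + q₁ ^ 2)⟩

/-- The point `m + l n` of the bisector of the segment `p p'`, where `m` is the midpoint and
`n = (b - b', a' - a)` for `p = (a, b)`, `p' = (a', b')`. -/
def bisectorPoint (p p' : ℂ) (l : ℝ) : ℂ :=
  (p + p') / 2 + (l : ℂ) * ⟨p.im - p'.im, p'.re - p.re⟩

/-- Up to relabelling the legs, choosing the unit length and the reference frame, and translating
the two realisations independently (which changes their relative position, but not their relative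
orientation), the pair `(X, X')` is as follows. The second realisation has base `x` and
platform `p'`; the first one is obtained from the configuration with base `x` and platform `p` by
the rotation about the origin with parameters `(f₀ : f₁)`. -/
def HasNormalForm (X X' : Config) (f₀ f₁ : ℝ) (x p p' : Fin 3 → ℂ) : Prop :=
  (f₀, f₁) ≠ (0, 0) ∧
    ∃ (π : Equiv.Perm (Fin 3)) (c t t' : ℂ), c ≠ 0 ∧
      (∀ i, c * X.base (π i) + t = bgMap f₀ f₁ 0 0 (x i)) ∧
      (∀ i, c * X.platform (π i) + t = bgMap f₀ f₁ 0 0 (p i)) ∧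
      (∀ i, c * X'.base (π i) + t' = x i) ∧
      (∀ i, c * X'.platform (π i) + t' = p' i)

/-- Case (I, i): rotation of the platform, `x₅ ≠ x₅'` and `x₆ ≠ x₆'`. -/
def CaseI_i (X X' : Config) (e₀ e₁ f₀ f₁ a₅ b₅ a₆ b₆ l₁ l₂ l₃ : ℝ) : Prop :=
  let p : Fin 3 → ℂ := ![⟨0, 1⟩, ⟨a₅, b₅⟩, ⟨a₆, b₆⟩]
  let p' : Fin 3 → ℂ := fun i => bgMap e₀ e₁ 0 0 (p i)
  e₁ ≠ 0 ∧ p 1 ≠ p' 1 ∧ p 2 ≠ p' 2 ∧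
    HasNormalForm X X' f₀ f₁
      ![bisectorPoint (p 0) (p' 0) l₁, bisectorPoint (p 1) (p' 1) l₂,
        bisectorPoint (p 2) (p' 2) l₃] p p'

/-- Case (I, ii): rotation of the platform, `x₅ ≠ x₅'` and `x₆ = x₆'`. -/
def CaseI_ii (X X' : Config) (e₀ e₁ f₀ f₁ a₃ b₃ a₅ b₅ l₁ l₂ : ℝ) : Prop :=
  let p : Fin 3 → ℂ := ![⟨0, 1⟩, ⟨a₅, b₅⟩, 0]
  let p' : Fin 3 → ℂ := fun i => bgMap e₀ e₁ 0 0 (p i)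
  e₁ ≠ 0 ∧ p 1 ≠ p' 1 ∧
    HasNormalForm X X' f₀ f₁
      ![bisectorPoint (p 0) (p' 0) l₁, bisectorPoint (p 1) (p' 1) l₂, ⟨a₃, b₃⟩] p p'

/-- Case (I, iii): rotation of the platform, `x₅ = x₅'` and `x₆ = x₆'`. -/
def CaseI_iii (X X' : Config) (e₀ e₁ f₀ f₁ a₂ b₂ a₃ b₃ l₁ : ℝ) : Prop :=
  let p : Fin 3 → ℂ := ![⟨0, 1⟩, 0, 0]
  let p' : Fin 3 → ℂ := fun i => bgMap e₀ e₁ 0 0 (p i)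
  e₁ ≠ 0 ∧
    HasNormalForm X X' f₀ f₁ ![bisectorPoint (p 0) (p' 0) l₁, ⟨a₂, b₂⟩, ⟨a₃, b₃⟩] p p'

/-- Case (II): translation of the platform by `(1, 0)`. -/
def CaseII (X X' : Config) (f₀ f₁ a₅ b₅ a₆ b₆ l₁ l₂ l₃ : ℝ) : Prop :=
  let p : Fin 3 → ℂ := ![0, ⟨a₅, b₅⟩, ⟨a₆, b₆⟩]
  let p' : Fin 3 → ℂ := fun i => bgMap 1 0 0 (1 / 2) (p i)
  HasNormalForm X X' f₀ f₁
    ![bisectorPoint (p 0) (p' 0) l₁, bisectorPoint (p 1) (p' 1) l₂,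
      bisectorPoint (p 2) (p' 2) l₃] p p'

def polyI_i (e₀ e₁ f₀ f₁ a₅ b₅ a₆ b₆ l₁ l₂ l₃ : ℝ) : ℝ :=
  (e₀ - 2 * e₁ * l₂) * a₆ * (a₅ ^ 2 + b₅ ^ 2) * (f₁ + 2 * l₁ * f₀) * (f₁ + 2 * l₃ * f₀)
    - (e₀ - 2 * e₁ * l₃) * a₅ * (a₆ ^ 2 + b₆ ^ 2) * (f₁ + 2 * l₁ * f₀) * (f₁ + 2 * l₂ * f₀)
    + (e₀ - 2 * e₁ * l₁) * (a₅ * b₆ - a₆ * b₅) * (f₁ + 2 * l₂ * f₀) * (f₁ + 2 * l₃ * f₀)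

def polyI_ii (e₀ e₁ f₀ f₁ a₃ b₃ a₅ b₅ l₁ l₂ : ℝ) : ℝ :=
  (e₀ - 2 * e₁ * l₂) * (a₅ ^ 2 + b₅ ^ 2) * (a₃ * e₀ + b₃ * e₁) * (f₁ + 2 * f₀ * l₁)
    - (e₀ - 2 * e₁ * l₁) * ((a₃ * b₅ - a₅ * b₃) * e₀ + (a₃ * a₅ + b₃ * b₅) * e₁)
      * (f₁ + 2 * f₀ * l₂)

def polyII (f₀ f₁ a₅ a₆ l₁ l₂ l₃ : ℝ) : ℝ :=
  a₅ * (l₁ - l₃) * (f₁ + 2 * f₀ * l₂) - a₆ * (l₁ - l₂) * (f₁ + 2 * f₀ * l₃)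

end RPR

end

noncomputable section

namespace RPR

/-! Move the first realisation so that its base falls on that of the second. The two platforms then
differ by a direct isometry, a rotation or a translation, and since leg lengths agree, each base
point is equidistant from the two positions of its platform point. For a rotation this puts the base
point on a line through the centre (unless the platform point is the centre itself); for a
translation the bisectors are parallel. After averaging, the legs are therefore concurrent
(`flexionOrder_average_of_rotation`) or parallel (`flexionOrder_of_caseII`), so the average has a
first order flex: the rotation about the common point, or the translation orthogonal to the legs.

Take linear coordinates `x` at the identity pose whose `x₁`-axis is this flex. Up to terms in `(x₀,
x₁, x₂, x₃)(x₀, x₂, x₃)`, the four equations are combinations of `x₀, x₁², x₂, x₃` with a constant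
matrix `A` (`HasLeadingTerms`). The multiplicity is always at least 2. If `A` is invertible,
Nakayama's lemma shows that it is at most 2; a kernel vector of `A` yields either a second
independent flex or a second order flex, and multiplicity at least 3. Both directions meet in
`HasLeadingTerms.three_le_iff`. The expansion is required over every commutative `ℂ`-algebra because
it is evaluated in power series for the lower bounds and in the local ring for the upper one.

It remains to compute `det A`: up to nonzero factors it is the stated polynomial in each normal
form. Existence of a normal form is the initial normalisation in coordinates, split by how many
platform points are fixed by the relative rotation. -/

/-- The local ring of affine space at `p`. -/
abbrev LocalRing (p : Fin 4 → ℂ) : Type := Localization.AtPrime (idealAt p)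

/-- The germ at `p` of a polynomial. -/
abbrev germ (p : Fin 4 → ℂ) : MvPolynomial (Fin 4) ℂ →+* LocalRing p := algebraMap _ _

/-- The ideal of the local ring at `p` that is generated by the system `c`. -/
abbrev germIdeal (c : Fin 4 → MvPolynomial (Fin 4) ℂ) (p : Fin 4 → ℂ) : Ideal (LocalRing p) :=
  (Ideal.span (Set.range c)).map (germ p)

/-- Turns multiplicity into lengths of chains of ideals above the ideal of the system, so that lower
bounds need only an explicit chain. -/
lemma solutionMultiplicity_eq_coheight (c : Fin 4 → MvPolynomial (Fin 4) ℂ) (p : Fin 4 → ℂ) :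
    solutionMultiplicity c p = Order.coheight (germIdeal c p) :=
  Module.length_quotient

lemma two_le_coheight {α : Type*} [PartialOrder α] {a b c d : α} (h₁ : a ≤ b) (h₂ : b < c)
    (h₃ : c < d) : 2 ≤ Order.coheight a := by
  have e₂ := Order.coheight_add_one_le h₂
  have e₃ := Order.coheight_add_one_le h₃
  calc (2 : ℕ∞) = 0 + 1 + 1 := by norm_num
    _ ≤ Order.coheight d + 1 + 1 := by gcongr; exact bot_le
    _ ≤ Order.coheight c + 1 := by gcongr
    _ ≤ Order.coheight b := e₂
    _ ≤ Order.coheight a := Order.coheight_anti h₁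

lemma three_le_coheight {α : Type*} [PartialOrder α] {a b c d e : α} (h₁ : a ≤ b) (h₂ : b < c)
    (h₃ : c < d) (h₄ : d < e) : 3 ≤ Order.coheight a := by
  have := two_le_coheight le_rfl h₃ h₄
  calc (3 : ℕ∞) = 2 + 1 := by norm_num
    _ ≤ Order.coheight c + 1 := by gcongr
    _ ≤ Order.coheight b := Order.coheight_add_one_le h₂
    _ ≤ Order.coheight a := Order.coheight_anti h₁

/-! ### Lower bounds from formal curves -/

open PowerSeries in
lemma constantCoeff_aeval {p : Fin 4 → ℂ} {q : Fin 4 → ℂ⟦X⟧}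
    (hq : ∀ j, constantCoeff (q j) = p j) (f : MvPolynomial (Fin 4) ℂ) :
    constantCoeff (MvPolynomial.aeval q f) = MvPolynomial.eval p f := by
  have : (constantCoeff (R := ℂ)).comp (MvPolynomial.aeval q : _ →ₐ[ℂ] ℂ⟦X⟧).toRingHom
      = MvPolynomial.eval p := by
    ext j
    · simp
    · simp [hq]
  exact congrArg (fun φ : MvPolynomial (Fin 4) ℂ →+* ℂ => φ f) this

-- A polynomial not vanishing at `p` has an invertible constant term along a formal curve through
-- `p`, so pulling back to the curve extends to germs.
open PowerSeries in
lemma exists_localization_hom {p : Fin 4 → ℂ} {q : Fin 4 → ℂ⟦X⟧}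
    (hq : ∀ j, constantCoeff (q j) = p j) :
    ∃ ψ : LocalRing p →+* ℂ⟦X⟧, ∀ f, ψ (germ p f) = MvPolynomial.aeval q f := by
  refine ⟨IsLocalization.lift (M := (idealAt p).primeCompl)
    (g := (MvPolynomial.aeval q : MvPolynomial (Fin 4) ℂ →ₐ[ℂ] ℂ⟦X⟧).toRingHom) ?_,
    fun f => ?_⟩
  · rintro ⟨f, hf⟩
    rw [PowerSeries.isUnit_iff_constantCoeff]
    exact isUnit_iff_ne_zero.2 fun h => hf ((constantCoeff_aeval hq f).symm.trans h)
  · rw [IsLocalization.lift_eq]; rfl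

open PowerSeries in
/-- The ideal of the functions that vanish to order `n` along a formal curve. -/
def orderIdeal {R : Type*} [CommRing R] (ψ : R →+* ℂ⟦X⟧) (n : ℕ) : Ideal R :=
  (Ideal.span {(X : ℂ⟦X⟧) ^ n}).comap ψ

open PowerSeries in
lemma mem_orderIdeal {R : Type*} [CommRing R] {ψ : R →+* ℂ⟦X⟧} {n : ℕ} {f : R} :
    f ∈ orderIdeal ψ n ↔ X ^ n ∣ ψ f := by
  simp [orderIdeal, Ideal.mem_span_singleton]

open PowerSeries in
lemma germIdeal_le_orderIdeal {c : Fin 4 → MvPolynomial (Fin 4) ℂ} {p : Fin 4 → ℂ}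
    {q : Fin 4 → ℂ⟦X⟧} {ψ : LocalRing p →+* ℂ⟦X⟧}
    (hψ : ∀ f, ψ (germ p f) = MvPolynomial.aeval q f) {n : ℕ}
    (hc : ∀ i, X ^ n ∣ MvPolynomial.aeval q (c i)) :
    germIdeal c p ≤ orderIdeal ψ n := by
  rw [Ideal.map_le_iff_le_comap, Ideal.span_le]
  rintro _ ⟨i, rfl⟩
  change germ p (c i) ∈ orderIdeal ψ n
  rw [mem_orderIdeal, hψ]
  exact hc i

-- If `g` has order exactly one along the curve, then `g ^ n` has order exactly `n` and separates
-- consecutive order ideals.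
open PowerSeries in
lemma orderIdeal_lt {R : Type*} [CommRing R] {ψ : R →+* ℂ⟦X⟧} {g : R} {s : ℂ⟦X⟧}
    (hg : ψ g = X * s) (hs : constantCoeff s ≠ 0) (n : ℕ) :
    orderIdeal ψ (n + 1) < orderIdeal ψ n := by
  refine lt_of_le_of_ne (fun f hf => ?_) fun h => ?_
  · rw [mem_orderIdeal] at hf ⊢
    exact (pow_dvd_pow _ n.le_succ).trans hf
  · have h₁ : g ^ n ∈ orderIdeal ψ (n + 1) := by
      rw [h, mem_orderIdeal, map_pow, hg, mul_pow]
      exact dvd_mul_right _ _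
    rw [mem_orderIdeal, map_pow, hg, mul_pow, pow_succ] at h₁
    have h₂ := (mul_dvd_mul_iff_left (pow_ne_zero n (X_ne_zero (R := ℂ)))).1 h₁
    rw [X_dvd_iff, map_pow] at h₂
    exact hs (eq_zero_of_pow_eq_zero h₂)

open PowerSeries in
/-- A formal curve through `p` with the given first and second order terms. -/
def curve (p v a : Fin 4 → ℂ) (j : Fin 4) : ℂ⟦X⟧ := C (p j) + X * (C (v j) + X * C (a j))

open PowerSeries in
lemma constantCoeff_curve (p v a : Fin 4 → ℂ) (j : Fin 4) :
    constantCoeff (curve p v a j) = p j := by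
  simp [curve]

open PowerSeries in
lemma aeval_curve_linear (p v a μ : Fin 4 → ℂ) :
    MvPolynomial.aeval (curve p v a)
      (∑ j, MvPolynomial.C (μ j) * (MvPolynomial.X j - MvPolynomial.C (p j)))
      = X * (C (∑ j, μ j * v j) + X * C (∑ j, μ j * a j)) := by
  simp only [map_sum, map_mul, map_sub, MvPolynomial.aeval_X, MvPolynomial.aeval_C, curve,
    PowerSeries.algebraMap_apply, Algebra.algebraMap_self, RingHom.id_apply, Finset.mul_sum,
    ← Finset.sum_add_distrib]
  exact Finset.sum_congr rfl fun j _ => by ring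

open PowerSeries in
/-- A formal curve with nonzero velocity on which the system vanishes to second order shows that
the solution is multiple. -/
lemma two_le_solutionMultiplicity {c : Fin 4 → MvPolynomial (Fin 4) ℂ} {p v a μ : Fin 4 → ℂ}
    (hμ : ∑ j, μ j * v j ≠ 0) (hc : ∀ i, X ^ 2 ∣ MvPolynomial.aeval (curve p v a) (c i)) :
    2 ≤ solutionMultiplicity c p := by
  obtain ⟨ψ, hψ⟩ := exists_localization_hom (constantCoeff_curve p v a)
  have hg := (hψ _).trans (aeval_curve_linear p v a μ)
  have hs : constantCoeff (C (∑ j, μ j * v j) + X * C (∑ j, μ j * a j)) ≠ 0 := by simpa using hμ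
  rw [solutionMultiplicity_eq_coheight]
  exact two_le_coheight (germIdeal_le_orderIdeal hψ hc) (orderIdeal_lt hg hs 1)
    (orderIdeal_lt hg hs 0)

open PowerSeries in
/-- A formal curve with nonzero velocity on which the system vanishes to third order shows that
the multiplicity is at least three. -/
lemma three_le_solutionMultiplicity {c : Fin 4 → MvPolynomial (Fin 4) ℂ} {p v a μ : Fin 4 → ℂ}
    (hμ : ∑ j, μ j * v j ≠ 0) (hc : ∀ i, X ^ 3 ∣ MvPolynomial.aeval (curve p v a) (c i)) :
    3 ≤ solutionMultiplicity c p := by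
  obtain ⟨ψ, hψ⟩ := exists_localization_hom (constantCoeff_curve p v a)
  have hg := (hψ _).trans (aeval_curve_linear p v a μ)
  have hs : constantCoeff (C (∑ j, μ j * v j) + X * C (∑ j, μ j * a j)) ≠ 0 := by simpa using hμ
  rw [solutionMultiplicity_eq_coheight]
  exact three_le_coheight (germIdeal_le_orderIdeal hψ hc) (orderIdeal_lt hg hs 2)
    (orderIdeal_lt hg hs 1) (orderIdeal_lt hg hs 0)

open PowerSeries in
/-- Two independent first order flexes show that the multiplicity is at least three. -/
lemma three_le_solutionMultiplicity_of_two_flexes {c : Fin 4 → MvPolynomial (Fin 4) ℂ}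
    {p v w μ ν : Fin 4 → ℂ} (hμ : ∑ j, μ j * v j ≠ 0) (hν : ∑ j, ν j * v j = 0)
    (hw : ∑ j, ν j * w j ≠ 0)
    (hv : ∀ i, X ^ 2 ∣ MvPolynomial.aeval (curve p v 0) (c i))
    (hw' : ∀ i, X ^ 2 ∣ MvPolynomial.aeval (curve p w 0) (c i)) :
    3 ≤ solutionMultiplicity c p := by
  obtain ⟨ψ, hψ⟩ := exists_localization_hom (constantCoeff_curve p v 0)
  obtain ⟨χ, hχ⟩ := exists_localization_hom (constantCoeff_curve p w 0)
  have hg := (hψ _).trans (aeval_curve_linear p v 0 μ)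
  have hs : constantCoeff (C (∑ j, μ j * v j) + X * C (∑ j, μ j * (0 : Fin 4 → ℂ) j)) ≠ 0 := by
    simpa using hμ
  rw [solutionMultiplicity_eq_coheight]
  refine three_le_coheight
    (le_inf (germIdeal_le_orderIdeal hψ hv) (germIdeal_le_orderIdeal hχ hw'))
    (inf_lt_left.2 fun h => ?_) (orderIdeal_lt hg hs 1) (orderIdeal_lt hg hs 0)
  -- The linear form `ν` vanishes identically along the first curve but has order exactly one along
  -- the second, so intersecting the two order ideals gives a third strict step.
  have h₁ : germ p (∑ j, MvPolynomial.C (ν j) * (MvPolynomial.X j - MvPolynomial.C (p j)))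
      ∈ orderIdeal ψ 2 := by
    rw [mem_orderIdeal, hψ, aeval_curve_linear, hν]
    simp
  have h₂ := h h₁
  rw [mem_orderIdeal, hχ, aeval_curve_linear, pow_two,
    mul_dvd_mul_iff_left (X_ne_zero (R := ℂ)), X_dvd_iff] at h₂
  exact hw (by simpa using h₂)

/-! ### An upper bound -/

/-- If the maximal ideal of a local ring is `N + (t)`, and kills `t` modulo `N`, then the quotient
by `N` has length at most two. -/
lemma coheight_le_two {R : Type*} [CommRing R] [IsLocalRing R] {N : Ideal R} {t : R}
    (hm : IsLocalRing.maximalIdeal R ≤ N ⊔ Ideal.span {t})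
    (ht : ∀ x ∈ IsLocalRing.maximalIdeal R, x * t ∈ N) : Order.coheight N ≤ 2 := by
  have hmax : ∀ I : Ideal R, IsLocalRing.maximalIdeal R < I → I = ⊤ := fun I hI => by
    by_contra h
    exact absurd (IsLocalRing.le_maximalIdeal h) (not_le_of_gt hI)
  have h₁ : Order.coheight (IsLocalRing.maximalIdeal R) ≤ 1 :=
    Order.coheight_le_coe_iff.2 fun I hI => by simp [hmax I hI]
  refine Order.coheight_le_coe_iff.2 fun I hI => ?_
  have hI' : IsLocalRing.maximalIdeal R ≤ I := by
    by_cases hI₀ : I = ⊤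
    · simp [hI₀]
    obtain ⟨f, hfI, hfN⟩ := Set.exists_of_ssubset hI
    obtain ⟨n, hn, s, hs, rfl⟩ := Submodule.mem_sup.1 (hm (IsLocalRing.le_maximalIdeal hI₀ hfI))
    obtain ⟨u, rfl⟩ := Ideal.mem_span_singleton'.1 hs
    -- An element `n + u * t` of `I` outside `N` must have `u` invertible, since the maximal ideal
    -- sends `t` into `N`. Hence `t`, and with it the maximal ideal, lies in `I`.
    have hu : IsUnit u := by
      by_contra hu
      exact hfN (N.add_mem hn (ht u ((IsLocalRing.mem_maximalIdeal u).2 hu)))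
    have htI : t ∈ I := (I.unit_mul_mem_iff_mem hu).1 ((I.add_mem_iff_right (hI.le hn)).1 hfI)
    exact hm.trans (sup_le hI.le ((Ideal.span_singleton_le_iff_mem I).2 htI))
  exact lt_of_le_of_lt ((Order.coheight_anti hI').trans h₁) (by norm_num)

/-- Let `x₀, t, u, v` generate the maximal ideal. A system whose leading part is an invertible
linear combination of `x₀, t², u, v` has multiplicity at most two. -/
lemma coheight_le_two_of_leading_terms {R : Type*} [CommRing R] [IsLocalRing R]
    {J : Ideal R} {x₀ t u v : R}
    (hm : IsLocalRing.maximalIdeal R ≤ Ideal.span {x₀, t, u, v})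
    (A : Matrix (Fin 4) (Fin 4) R) (hA : IsUnit A.det)
    (hJ : ∀ i, A.mulVec ![x₀, t ^ 2, u, v] i ∈ J ⊔
      IsLocalRing.maximalIdeal R • Ideal.span (Set.range ![x₀, t ^ 2, u, v])) :
    Order.coheight J ≤ 2 := by
  set n : Fin 4 → R := ![x₀, t ^ 2, u, v]
  -- Nakayama: inverting `A` places the ideal of the leading terms inside `J` plus the maximal ideal
  -- times itself.
  have hN : Ideal.span (Set.range n) ≤ J := by
    refine Submodule.le_of_le_smul_of_le_jacobson_bot (Submodule.fg_span (Set.finite_range n))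
      (IsLocalRing.maximalIdeal_le_jacobson ⊥) ?_
    rw [Ideal.span_le]
    rintro _ ⟨i, rfl⟩
    have : n i = ∑ j, A⁻¹ i j * A.mulVec n j := by
      conv_lhs => rw [← Matrix.one_mulVec n, ← Matrix.nonsing_inv_mul A hA, ← Matrix.mulVec_mulVec]
      rfl
    rw [SetLike.mem_coe, this]
    exact Ideal.sum_mem _ fun j _ => Ideal.mul_mem_left _ _ (hJ j)
  refine (Order.coheight_anti hN).trans (coheight_le_two (t := t) ?_ fun x hx => ?_)
  · have hn : ∀ i, n i ∈ Ideal.span (Set.range n) := fun i => Ideal.subset_span ⟨i, rfl⟩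
    refine hm.trans (Ideal.span_le.2 ?_)
    rintro x (rfl | rfl | rfl | rfl)
    · exact Ideal.mem_sup_left (hn 0)
    · exact Ideal.mem_sup_right (Ideal.mem_span_singleton_self _)
    · exact Ideal.mem_sup_left (hn 2)
    · exact Ideal.mem_sup_left (hn 3)
  · have hn : ∀ i, n i ∈ Ideal.span (Set.range n) := fun i => Ideal.subset_span ⟨i, rfl⟩
    obtain ⟨a, b, c, d, rfl⟩ : ∃ a b c d, x = a * x₀ + b * t + c * u + d * v := by
      simpa [Ideal.mem_span_insert, Ideal.mem_span_singleton', add_assoc, eq_comm] using hm hx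
    have := Ideal.add_mem _ (Ideal.add_mem _ (Ideal.mul_mem_left _ (a * t) (hn 0))
      (Ideal.mul_mem_left _ b (hn 1))) (Ideal.add_mem _ (Ideal.mul_mem_left _ (c * t) (hn 2))
      (Ideal.mul_mem_left _ (d * t) (hn 3)))
    convert this using 1
    simp [n]; ring

/-- Every polynomial is congruent to its value at `p` modulo the forms `X j - p j`, so the germs of
these generate the maximal ideal. -/
lemma maximalIdeal_localRing_le (p : Fin 4 → ℂ) {I : Ideal (LocalRing p)}
    (hI : ∀ j, germ p (MvPolynomial.X j - MvPolynomial.C (p j)) ∈ I) :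
    IsLocalRing.maximalIdeal (LocalRing p) ≤ I := by
  rw [← Localization.AtPrime.map_eq_maximalIdeal, Ideal.map_le_iff_le_comap]
  intro f hf
  have h : ∀ g : MvPolynomial (Fin 4) ℂ,
      g - MvPolynomial.C (MvPolynomial.eval p g) ∈ I.comap (germ p) := fun g => by
    induction g using MvPolynomial.induction_on with
    | C a => simp
    | add g₁ g₂ h₁ h₂ =>
      convert Ideal.add_mem _ h₁ h₂ using 1
      simp only [map_add]; ring
    | mul_X g j hg =>
      convert Ideal.add_mem _ (Ideal.mul_mem_right (MvPolynomial.X j) _ hg)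
        (Ideal.mul_mem_left _ (MvPolynomial.C (MvPolynomial.eval p g)) (hI j)) using 1
      simp only [map_mul, MvPolynomial.eval_X]; ring
  have := h f
  rwa [show MvPolynomial.eval p f = 0 from hf, map_zero, sub_zero] at this

/-! ### Multiplicity of a solution of corank one with prescribed leading terms -/

/-- The monomials `x₀, x₁², x₂, x₃`. -/
def leadMonomials {B : Type} [CommRing B] (x : Fin 4 → B) : Fin 4 → B :=
  ![x 0, x 1 ^ 2, x 2, x 3]

/-- In the affine coordinates `x` with `q = p + M x`, the system `c` has the linear combinations of
`x₀, x₁², x₂, x₃` with coefficient matrix `A` as leading terms: the remainders lie in the product of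
the ideals `(x₀, x₁, x₂, x₃)` and `(x₀, x₂, x₃)`. -/
def HasLeadingTerms (c : Fin 4 → MvPolynomial (Fin 4) ℂ) (p : Fin 4 → ℂ)
    (M A : Matrix (Fin 4) (Fin 4) ℂ) : Prop :=
  ∀ (B : Type) [CommRing B] [Algebra ℂ B] (x : Fin 4 → B) (i : Fin 4), ∃ r : Fin 4 → B,
    (∀ k, r k ∈ Ideal.span (Set.range x)) ∧ r 1 = 0 ∧
    MvPolynomial.aeval (fun j => algebraMap ℂ B (p j) + ∑ k, algebraMap ℂ B (M j k) * x k) (c i)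
      = ∑ k, algebraMap ℂ B (A i k) * leadMonomials x k + ∑ k, r k * x k

open PowerSeries in
lemma HasLeadingTerms.aeval_curve {c : Fin 4 → MvPolynomial (Fin 4) ℂ} {p : Fin 4 → ℂ}
    {M A : Matrix (Fin 4) (Fin 4) ℂ} (h : HasLeadingTerms c p M A) (v a : Fin 4 → ℂ) (i : Fin 4) :
    ∃ s : Fin 4 → ℂ⟦X⟧, s 1 = 0 ∧
      MvPolynomial.aeval (curve p (M.mulVec v) (M.mulVec a)) (c i)
        = ∑ k, C (A i k) * leadMonomials (fun k => X * (C (v k) + X * C (a k))) k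
          + ∑ k, X ^ 2 * (s k * (C (v k) + X * C (a k))) := by
  obtain ⟨r, hr, hr₁, e⟩ := h ℂ⟦X⟧ (fun k => X * (C (v k) + X * C (a k))) i
  have hX : ∀ k, (X : ℂ⟦X⟧) ∣ r k := fun k => by
    refine Ideal.mem_span_singleton.1 ((Ideal.span_le.2 ?_) (hr k))
    rintro _ ⟨k, rfl⟩
    exact Ideal.mem_span_singleton.2 (dvd_mul_right _ _)
  choose s hs using hX
  refine ⟨s, ?_, ?_⟩
  · have := hs 1
    rw [hr₁] at this
    exact (mul_eq_zero.1 this.symm).resolve_left X_ne_zero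
  · have hq : curve p (M.mulVec v) (M.mulVec a) = fun j => algebraMap ℂ ℂ⟦X⟧ (p j)
        + ∑ k, algebraMap ℂ ℂ⟦X⟧ (M j k) * (X * (C (v k) + X * C (a k))) := by
      funext j
      simp only [curve, Matrix.mulVec, dotProduct, PowerSeries.algebraMap_apply,
        Algebra.algebraMap_self, RingHom.id_apply, map_sum, map_mul, Finset.mul_sum,
        ← Finset.sum_add_distrib]
      congr 1
      exact Finset.sum_congr rfl fun j _ => by ring
    rw [hq, e]
    congr 1
    exact Finset.sum_congr rfl fun k _ => by rw [hs k]; ring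

lemma sum_inv_row_mul_mulVec {M : Matrix (Fin 4) (Fin 4) ℂ} (hM : IsUnit M.det) (n : Fin 4 → ℂ)
    (k : Fin 4) : ∑ j, M⁻¹ k j * M.mulVec n j = n k := by
  conv_rhs => rw [← Matrix.one_mulVec n, ← Matrix.nonsing_inv_mul M hM, ← Matrix.mulVec_mulVec]
  rfl

-- Along the `x₁`-axis the only surviving leading monomial is `x₁²`, so every equation vanishes to
-- second order.
open PowerSeries in
theorem HasLeadingTerms.two_le {c : Fin 4 → MvPolynomial (Fin 4) ℂ} {p : Fin 4 → ℂ}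
    {M A : Matrix (Fin 4) (Fin 4) ℂ} (hM : IsUnit M.det) (h : HasLeadingTerms c p M A) :
    2 ≤ solutionMultiplicity c p := by
  refine two_le_solutionMultiplicity (v := M.mulVec ![0, 1, 0, 0]) (a := M.mulVec 0) (μ := M⁻¹ 1)
    (by rw [sum_inv_row_mul_mulVec hM]; simp) fun i => ?_
  obtain ⟨s, hs, e⟩ := h.aeval_curve ![0, 1, 0, 0] 0 i
  rw [e]
  refine dvd_add (Finset.dvd_sum fun k _ => Dvd.dvd.mul_left ?_ _)
    (Finset.dvd_sum fun k _ => dvd_mul_right _ _)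
  fin_cases k <;> simp [leadMonomials]

open PowerSeries in
theorem HasLeadingTerms.three_le {c : Fin 4 → MvPolynomial (Fin 4) ℂ} {p : Fin 4 → ℂ}
    {M A : Matrix (Fin 4) (Fin 4) ℂ} (hM : IsUnit M.det) (h : HasLeadingTerms c p M A)
    (hA : A.det = 0) : 3 ≤ solutionMultiplicity c p := by
  obtain ⟨n, hn, hAn⟩ := Matrix.exists_mulVec_eq_zero_iff.2 hA
  -- With `n 1 = 0` the kernel vector is tangent to a second first order flex, independent of the
  -- `x₁`-axis.
  by_cases hn₁ : n 1 = 0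
  · obtain ⟨k, hk⟩ := Function.ne_iff.1 hn
    have hk₁ : k ≠ 1 := by rintro rfl; exact hk hn₁
    refine three_le_solutionMultiplicity_of_two_flexes (v := M.mulVec ![0, 1, 0, 0])
      (w := M.mulVec n) (μ := M⁻¹ 1) (ν := M⁻¹ k) (by rw [sum_inv_row_mul_mulVec hM]; simp)
      (by rw [sum_inv_row_mul_mulVec hM]; fin_cases k <;> simp_all)
      (by rw [sum_inv_row_mul_mulVec hM]; exact hk) (fun i => ?_) fun i => ?_
    · obtain ⟨s, hs, e⟩ := h.aeval_curve ![0, 1, 0, 0] 0 i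
      rw [Matrix.mulVec_zero] at e
      rw [e]
      refine dvd_add (Finset.dvd_sum fun k _ => Dvd.dvd.mul_left ?_ _)
        (Finset.dvd_sum fun k _ => dvd_mul_right _ _)
      fin_cases k <;> simp [leadMonomials]
    · obtain ⟨s, hs, e⟩ := h.aeval_curve n 0 i
      rw [Matrix.mulVec_zero] at e
      rw [e]
      refine dvd_add ((dvd_zero _).trans (Eq.dvd (Eq.symm ?_)))
        (Finset.dvd_sum fun k _ => dvd_mul_right _ _)
      have := congrArg (fun z => X * C z) (congrFun hAn i)
      simp only [Matrix.mulVec, dotProduct, Fin.sum_univ_four, map_add, map_mul, hn₁, Pi.zero_apply,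
        map_zero] at this
      simp [leadMonomials, Fin.sum_univ_four, hn₁]
      linear_combination this
  -- Otherwise rescale to `n 1 = 1` and use the parabola with velocity along `x₁` and the other
  -- entries of `n` as acceleration: its leading monomials are `X ^ 2` times the rescaled kernel
  -- vector.
  · refine three_le_solutionMultiplicity (v := M.mulVec ![0, 1, 0, 0])
      (a := M.mulVec ![n 0 / n 1, 0, n 2 / n 1, n 3 / n 1]) (μ := M⁻¹ 1)
      (by rw [sum_inv_row_mul_mulVec hM]; simp) fun i => ?_
    obtain ⟨s, hs, e⟩ := h.aeval_curve ![0, 1, 0, 0] ![n 0 / n 1, 0, n 2 / n 1, n 3 / n 1] i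
    rw [e]
    refine dvd_add ((dvd_zero _).trans (Eq.dvd (Eq.symm ?_))) (Finset.dvd_sum fun k _ => ?_)
    · have h₁ : A i 0 * (n 0 / n 1) + A i 1 + A i 2 * (n 2 / n 1) + A i 3 * (n 3 / n 1) = 0 := by
        have := congrFun hAn i
        simp only [Matrix.mulVec, dotProduct, Fin.sum_univ_four, Pi.zero_apply] at this
        field_simp
        linear_combination this
      have := congrArg (fun z => X ^ 2 * C z) h₁
      simp only [map_add, map_mul, map_zero] at this
      simp [leadMonomials, Fin.sum_univ_four]
      linear_combination this
    · rw [pow_succ]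
      refine mul_dvd_mul_left _ ?_
      fin_cases k <;> simp [hs] <;> exact Dvd.dvd.mul_left (dvd_mul_right _ _) _

/-- The universal expansion is evaluated at the germs of the coordinates `x = M⁻¹ (q - p)`, where
the remainders fall into the maximal ideal times `(x₀, x₁², x₂, x₃)`. -/
theorem HasLeadingTerms.le_two {c : Fin 4 → MvPolynomial (Fin 4) ℂ} {p : Fin 4 → ℂ}
    {M A : Matrix (Fin 4) (Fin 4) ℂ} (hM : IsUnit M.det) (h : HasLeadingTerms c p M A)
    (hA : A.det ≠ 0) : solutionMultiplicity c p ≤ 2 := by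
  set g : Fin 4 → LocalRing p := fun j => germ p (MvPolynomial.X j - MvPolynomial.C (p j))
  set x : Fin 4 → LocalRing p := fun k => ∑ j, algebraMap ℂ (LocalRing p) (M⁻¹ k j) * g j
  have hg : ∀ j, g j = ∑ k, algebraMap ℂ (LocalRing p) (M j k) * x k := fun j => by
    have h₁ : (M.map (algebraMap ℂ (LocalRing p))) * (M⁻¹.map (algebraMap ℂ (LocalRing p))) = 1 := by
      rw [← Matrix.map_mul, Matrix.mul_nonsing_inv _ hM]
      simp
    conv_lhs => rw [← Matrix.one_mulVec g, ← h₁, ← Matrix.mulVec_mulVec]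
    rfl
  have hC : ∀ z : ℂ, germ p (MvPolynomial.C z) = algebraMap ℂ (LocalRing p) z := fun z => by
    rw [IsScalarTower.algebraMap_apply ℂ (MvPolynomial (Fin 4) ℂ) (LocalRing p)]
    rfl
  have hq : ∀ f, MvPolynomial.aeval (fun j => algebraMap ℂ (LocalRing p) (p j)
      + ∑ k, algebraMap ℂ (LocalRing p) (M j k) * x k) f = germ p f := fun f => by
    have : (MvPolynomial.aeval (fun j => algebraMap ℂ (LocalRing p) (p j)
      + ∑ k, algebraMap ℂ (LocalRing p) (M j k) * x k) : _ →ₐ[ℂ] LocalRing p).toRingHom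
      = germ p := by
      ext j
      · simp [hC]
      · simp [← hg, g, hC]
    exact congrArg (fun φ : MvPolynomial (Fin 4) ℂ →+* LocalRing p => φ f) this
  have hgm : ∀ j, g j ∈ IsLocalRing.maximalIdeal (LocalRing p) := fun j => by
    rw [← Localization.AtPrime.map_eq_maximalIdeal]
    exact Ideal.mem_map_of_mem _ (by simp [idealAt, RingHom.mem_ker])
  have hxm : Ideal.span (Set.range x) ≤ IsLocalRing.maximalIdeal (LocalRing p) := by
    rw [Ideal.span_le]
    rintro _ ⟨k, rfl⟩
    exact Ideal.sum_mem _ fun j _ => Ideal.mul_mem_left _ _ (hgm j)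
  rw [solutionMultiplicity_eq_coheight]
  refine coheight_le_two_of_leading_terms (x₀ := x 0) (t := x 1) (u := x 2) (v := x 3)
    (maximalIdeal_localRing_le p fun j => ?_) (A.map (algebraMap ℂ (LocalRing p))) ?_ fun i => ?_
  · change g j ∈ _
    rw [hg]
    refine Ideal.sum_mem _ fun k _ => Ideal.mul_mem_left _ _ (Ideal.subset_span ?_)
    fin_cases k <;> simp
  · rw [← RingHom.mapMatrix_apply, ← RingHom.map_det]
    exact (isUnit_iff_ne_zero.2 hA).map _
  · obtain ⟨r, hr, hr₁, e⟩ := h (LocalRing p) x i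
    rw [hq] at e
    rw [show (A.map (algebraMap ℂ (LocalRing p))).mulVec ![x 0, x 1 ^ 2, x 2, x 3] i
      = germ p (c i) - ∑ k, r k * x k from eq_sub_of_add_eq e.symm]
    refine Submodule.sub_mem _ (Ideal.mem_sup_left
      (Ideal.mem_map_of_mem _ (Ideal.subset_span ⟨i, rfl⟩)))
      (Ideal.mem_sup_right (Ideal.sum_mem _ fun k _ => ?_))
    have hn : ∀ i, ![x 0, x 1 ^ 2, x 2, x 3] i
      ∈ Ideal.span (Set.range ![x 0, x 1 ^ 2, x 2, x 3]) := fun i => Ideal.subset_span ⟨i, rfl⟩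
    by_cases hk : k = 1
    · simp [hk, hr₁]
    · refine Ideal.mul_mem_mul (hxm (hr k)) ?_
      have := hn k
      fin_cases k <;> simp_all

theorem HasLeadingTerms.three_le_iff {c : Fin 4 → MvPolynomial (Fin 4) ℂ} {p : Fin 4 → ℂ}
    {M A : Matrix (Fin 4) (Fin 4) ℂ} (hM : IsUnit M.det) (h : HasLeadingTerms c p M A) :
    3 ≤ solutionMultiplicity c p ↔ A.det = 0 := by
  refine ⟨fun h₃ => ?_, h.three_le hM⟩
  by_contra hA
  exact absurd (h₃.trans (h.le_two hM hA)) (by norm_num)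

/-! ### Averages whose legs are concurrent or parallel -/

lemma one_le_flexionOrder_iff {Y : Config} :
    1 ≤ flexionOrder Y ↔ 2 ≤ solutionMultiplicity (constraints Y) idPose := by
  unfold flexionOrder
  generalize solutionMultiplicity (constraints Y) idPose = m
  cases m with
  | top => simp
  | coe n => norm_cast; omega

lemma two_le_flexionOrder_iff {Y : Config} :
    2 ≤ flexionOrder Y ↔ 3 ≤ solutionMultiplicity (constraints Y) idPose := by
  unfold flexionOrder
  generalize solutionMultiplicity (constraints Y) idPose = m
  cases m with
  | top => simp
  | coe n => norm_cast; omega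

/-! ### Leading terms of the leg constraints. -/

lemma aeval_legConstraint {B : Type} [CommRing B] [Algebra ℂ B] (q : Fin 4 → B)
    (a b a' b' r : ℝ) :
    MvPolynomial.aeval q (legConstraint a b a' b' r) =
      let k : ℝ → B := fun x => algebraMap ℂ B (x : ℂ)
      2 * k a * k a' * q 1 ^ 2 - 2 * k a * k a' * q 0 ^ 2 + 4 * k a * k b' * q 0 * q 1
    - 4 * k b * k a' * q 0 * q 1 - 2 * k b * k b' * q 0 ^ 2 + 2 * k b * k b' * q 1 ^ 2
    + (k a' ^ 2 + k b' ^ 2) * (q 0 ^ 2 + q 1 ^ 2)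
    - 4 * k a * (q 0 * q 3 + q 1 * q 2) + 4 * k b * (q 0 * q 2 - q 1 * q 3)
    + 4 * k a' * (q 0 * q 3 - q 1 * q 2) - 4 * k b' * (q 0 * q 2 + q 1 * q 3)
    + k a ^ 2 + k b ^ 2 + 4 * (q 2 ^ 2 + q 3 ^ 2) - k r ^ 2 := by
  simp [legConstraint]

/-- Half the derivative of the leg constraint with respect to `q₀` at the identity pose. -/
def radialTerm (y z : ℂ) : ℝ := z.re ^ 2 + z.im ^ 2 - 2 * (y.re * z.re + y.im * z.im)

lemma dist_sq_eq (y z : ℂ) : dist y z ^ 2 = (z.re - y.re) ^ 2 + (z.im - y.im) ^ 2 := by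
  rw [Complex.dist_eq, Complex.sq_norm, Complex.normSq_apply, Complex.sub_re, Complex.sub_im]
  ring

/-- The formula for the leg constraint in terms of the embedding `κ` of the real numbers. -/
lemma aeval_constraints_succ {B : Type} [CommRing B] [Algebra ℂ B] (Y : Config) (q : Fin 4 → B)
    (i : Fin 3) {κ : ℝ →+* B} (hκ : κ = (algebraMap ℂ B).comp Complex.ofRealHom) :
    MvPolynomial.aeval q (constraints Y i.succ) =
      (q 1 ^ 2 - q 0 ^ 2) * 2 * (κ (Y.base i).re * κ (Y.platform i).re
        + κ (Y.base i).im * κ (Y.platform i).im)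
      + 4 * q 0 * q 1 * (κ (Y.base i).re * κ (Y.platform i).im
        - κ (Y.base i).im * κ (Y.platform i).re)
      + (q 0 ^ 2 + q 1 ^ 2 - 1) * (κ (Y.platform i).re ^ 2 + κ (Y.platform i).im ^ 2)
      - 4 * κ (Y.base i).re * (q 0 * q 3 + q 1 * q 2)
      + 4 * κ (Y.base i).im * (q 0 * q 2 - q 1 * q 3)
      + 4 * κ (Y.platform i).re * (q 0 * q 3 - q 1 * q 2)
      - 4 * κ (Y.platform i).im * (q 0 * q 2 + q 1 * q 3) + 4 * (q 2 ^ 2 + q 3 ^ 2)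
      + 2 * (κ (Y.base i).re * κ (Y.platform i).re + κ (Y.base i).im * κ (Y.platform i).im) := by
  have hκ' : ∀ t : ℝ, algebraMap ℂ B (t : ℂ) = κ t := fun _ => by rw [hκ]; rfl
  have e := congrArg κ (dist_sq_eq (Y.base i) (Y.platform i))
  simp only [map_add, map_sub, map_pow] at e
  simp only [constraints, Fin.cons_succ, aeval_legConstraint, hκ']
  linear_combination -e

/-- The second column of the coordinate matrix is the infinitesimal rotation about `P`, which moves
each platform point orthogonally to its leg. -/
lemma hasLeadingTerms_of_concurrent (Y : Config) (P : ℂ)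
    (h : ∀ i, (Y.base i - P).re * (Y.platform i - P).im
      = (Y.base i - P).im * (Y.platform i - P).re) :
    HasLeadingTerms (constraints Y) idPose
      !![1, 0, 0, 0; 0, 1, 0, 0; 0, (P.re : ℂ), 1, 0; 0, (P.im : ℂ), 0, 1]
      (Matrix.of (Fin.cons ![2, 1, 0, 0] fun i =>
        ![((2 * radialTerm (Y.base i) (Y.platform i) : ℝ) : ℂ),
          ((4 * ((Y.base i - P).re * (Y.platform i - P).re
            + (Y.base i - P).im * (Y.platform i - P).im)
            + radialTerm (Y.base i) (Y.platform i) : ℝ) : ℂ),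
          ((-4 * (Y.platform i - Y.base i).im : ℝ) : ℂ),
          ((4 * (Y.platform i - Y.base i).re : ℝ) : ℂ)])) := by
  intro B _ _ x i
  have hx : ∀ (b : B) k, b * x k ∈ Ideal.span (Set.range x) :=
    fun b k => Ideal.mul_mem_left _ _ (Ideal.subset_span ⟨k, rfl⟩)
  refine Fin.cases ?_ (fun i => ?_) i
  · refine ⟨![1 * x 0, 0, 0, 0], fun k => ?_, rfl, ?_⟩
    · fin_cases k
      exacts [hx _ 0, zero_mem _, zero_mem _, zero_mem _]
    · simp [constraints, normalisation, Fin.sum_univ_four, leadMonomials, idPose,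
        map_ofNat (algebraMap ℂ B)]
      ring
  · set κ : ℝ →+* B := (algebraMap ℂ B).comp Complex.ofRealHom with hκ
    have hκ' : ∀ t : ℝ, algebraMap ℂ B (t : ℂ) = κ t := fun _ => rfl
    have e := congrArg κ (h i)
    refine ⟨![κ (radialTerm (Y.base i) (Y.platform i)) * x 0, 0,
      κ (4 * ((Y.base i).im - (Y.platform i).im)) * x 0
        + κ (8 * P.re - 4 * ((Y.base i).re + (Y.platform i).re)) * x 1 + 4 * x 2,
      κ (4 * ((Y.platform i).re - (Y.base i).re)) * x 0
        + κ (8 * P.im - 4 * ((Y.base i).im + (Y.platform i).im)) * x 1 + 4 * x 3],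
      fun k => ?_, rfl, ?_⟩
    · fin_cases k
      exacts [hx _ 0, zero_mem _, add_mem (add_mem (hx _ 0) (hx _ 1)) (hx _ 2),
        add_mem (add_mem (hx _ 0) (hx _ 1)) (hx _ 3)]
    · rw [aeval_constraints_succ Y _ i hκ]
      simp only [Matrix.of_apply, Fin.cons_succ, Fin.sum_univ_four, leadMonomials, idPose, hκ',
        Matrix.cons_val, map_zero, map_one]
      simp only [radialTerm, map_add, map_sub, map_mul, map_pow, map_neg,
        Complex.sub_re, Complex.sub_im, map_ofNat] at e ⊢
      -- The terms in `q₀ x₁` add up to four times the cross product of the two leg ends relative to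
      -- `P`, which vanishes by concurrency.
      linear_combination 4 * (1 + x 0) * x 1 * e

/-- Here `x₁` is the translation along `ω`, orthogonal to the legs, `x₃` the translation along them,
and `x₂` the rotation parameter `q₁`. -/
lemma hasLeadingTerms_of_parallel (Y : Config) (ω : ℂ) (k : Fin 3 → ℝ)
    (h : ∀ i, Y.platform i - Y.base i = ω * (Complex.I * k i)) :
    HasLeadingTerms (constraints Y) idPose
      !![1, 0, 0, 0; 0, 0, 1, 0; 0, (-ω.im : ℂ), 0, (-ω.re : ℂ); 0, (ω.re : ℂ), 0, (-ω.im : ℂ)]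
      (Matrix.of (Fin.cons ![2, 0, 0, 0] fun i =>
        ![((2 * radialTerm (Y.base i) (Y.platform i) : ℝ) : ℂ),
          ((4 * (ω.re ^ 2 + ω.im ^ 2) : ℝ) : ℂ),
          ((4 * ((Y.base i).re * (Y.platform i).im - (Y.base i).im * (Y.platform i).re) : ℝ) : ℂ),
          ((4 * (k i * (ω.re ^ 2 + ω.im ^ 2)) : ℝ) : ℂ)])) := by
  intro B _ _ x i
  have hx : ∀ (b : B) k, b * x k ∈ Ideal.span (Set.range x) :=
    fun b k => Ideal.mul_mem_left _ _ (Ideal.subset_span ⟨k, rfl⟩)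
  refine Fin.cases ?_ (fun i => ?_) i
  · refine ⟨![1 * x 0, 0, 1 * x 2, 0], fun k => ?_, rfl, ?_⟩
    · fin_cases k
      exacts [hx _ 0, zero_mem _, hx _ 2, zero_mem _]
    · simp [constraints, normalisation, Fin.sum_univ_four, leadMonomials, idPose,
        map_ofNat (algebraMap ℂ B)]
      ring
  · set κ : ℝ →+* B := (algebraMap ℂ B).comp Complex.ofRealHom with hκ
    have hκ' : ∀ t : ℝ, algebraMap ℂ B (t : ℂ) = κ t := fun _ => rfl
    have er : κ (Y.platform i).re = κ (Y.base i).re - κ ω.im * κ (k i) := by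
      rw [← map_mul, ← map_sub]
      congr 1
      have := congrArg Complex.re (h i)
      simp at this
      linarith
    have ei : κ (Y.platform i).im = κ (Y.base i).im + κ ω.re * κ (k i) := by
      rw [← map_mul, ← map_add]
      congr 1
      have := congrArg Complex.im (h i)
      simp at this
      linarith
    set s := -κ ω.im * x 1 - κ ω.re * x 3
    set t := κ ω.re * x 1 - κ ω.im * x 3
    refine ⟨![κ (radialTerm (Y.base i) (Y.platform i)) * x 0
        + κ (4 * ((Y.base i).re * (Y.platform i).im - (Y.base i).im * (Y.platform i).re)) * x 2
        + κ (4 * k i * (ω.re ^ 2 + ω.im ^ 2)) * x 3, 0,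
      κ (4 * ((Y.base i).re * (Y.platform i).re + (Y.base i).im * (Y.platform i).im)
        + radialTerm (Y.base i) (Y.platform i)) * x 2
        + κ (4 * ((Y.base i).re + (Y.platform i).re) * ω.im
          - 4 * ((Y.base i).im + (Y.platform i).im) * ω.re) * x 1
        + κ (4 * ((Y.base i).re + (Y.platform i).re) * ω.re
          + 4 * ((Y.base i).im + (Y.platform i).im) * ω.im) * x 3,
      κ (4 * (ω.re ^ 2 + ω.im ^ 2)) * x 3], fun k => ?_, rfl, ?_⟩
    · fin_cases k
      exacts [add_mem (add_mem (hx _ 0) (hx _ 2)) (hx _ 3), zero_mem _,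
        add_mem (add_mem (hx _ 2) (hx _ 1)) (hx _ 3), hx _ 3]
    · rw [aeval_constraints_succ Y _ i hκ]
      simp only [Matrix.of_apply, Fin.cons_succ, Fin.sum_univ_four, leadMonomials, idPose, hκ',
        Matrix.cons_val, map_zero, map_one, map_neg]
      simp only [radialTerm, map_add, map_sub, map_mul, map_pow, map_ofNat, er, ei]
      ring

/-! ### Determinants of the leading coefficients. -/

lemma det_leading_terms_of_concurrent (s h u v : Fin 3 → ℝ) :
    (Matrix.of (Fin.cons ![2, 1, 0, 0] fun i => ![((2 * s i : ℝ) : ℂ), ((4 * h i + s i : ℝ) : ℂ),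
      ((-4 * u i : ℝ) : ℂ), ((4 * v i : ℝ) : ℂ)] : Fin 4 → Fin 4 → ℂ)).det
      = ((128 * (Matrix.of fun i => ![h i, v i, u i]).det : ℝ) : ℂ) := by
  have h₂ (f : Fin 4 → ℂ) (g : Fin 3 → Fin 4 → ℂ) :
    (Fin.cons f g : Fin 4 → Fin 4 → ℂ) 2 = g 1 := rfl
  have h₃ (f : Fin 4 → ℂ) (g : Fin 3 → Fin 4 → ℂ) :
    (Fin.cons f g : Fin 4 → Fin 4 → ℂ) 3 = g 2 := rfl
  -- The entries `s i` cancel: subtracting half the first column from the second clears the top row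
  -- beyond its first entry.
  rw [Matrix.det_succ_row_zero, Matrix.det_fin_three]
  simp [Fin.sum_univ_succ, Matrix.det_fin_three, Fin.succAbove, h₂, h₃]
  ring

lemma det_leading_terms_of_parallel (s m k : Fin 3 → ℝ) (r : ℝ) :
    (Matrix.of (Fin.cons ![2, 0, 0, 0] fun i => ![((2 * s i : ℝ) : ℂ), ((4 * r : ℝ) : ℂ),
      ((4 * m i : ℝ) : ℂ), ((4 * (k i * r) : ℝ) : ℂ)] : Fin 4 → Fin 4 → ℂ)).det
      = ((128 * r ^ 2 * (Matrix.of fun i => ![m i, k i, 1]).det : ℝ) : ℂ) := by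
  have h₂ (f : Fin 4 → ℂ) (g : Fin 3 → Fin 4 → ℂ) :
    (Fin.cons f g : Fin 4 → Fin 4 → ℂ) 2 = g 1 := rfl
  have h₃ (f : Fin 4 → ℂ) (g : Fin 3 → Fin 4 → ℂ) :
    (Fin.cons f g : Fin 4 → Fin 4 → ℂ) 3 = g 2 := rfl
  rw [Matrix.det_succ_row_zero, Matrix.det_fin_three]
  simp [Fin.sum_univ_succ, Matrix.det_fin_three, Fin.succAbove, h₂, h₃]
  ring

lemma det_of_perm_eq_zero_iff (σ : Equiv.Perm (Fin 3)) (f : Fin 3 → Fin 3 → ℝ) :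
    (Matrix.of fun i => f (σ i)).det = 0 ↔ (Matrix.of f).det = 0 := by
  have := Matrix.det_permute σ (Matrix.of f)
  rw [show (Matrix.of fun i => f (σ i)) = (Matrix.of f).submatrix σ id from rfl, this]
  simp

lemma normSq_pos' {ω : ℂ} (hω : ω ≠ 0) : 0 < ω.re ^ 2 + ω.im ^ 2 := by
  have := Complex.normSq_pos.2 hω
  rw [Complex.normSq_apply] at this
  nlinarith

/-- The flexion order of a configuration whose legs pass through a common point `P`; after division
by `ω`, the anchor points have the positions `η i` and `ζ i` relative to `P`. -/
theorem flexionOrder_of_concurrent {Y : Config} {σ : Equiv.Perm (Fin 3)} {P ω : ℂ} (hω : ω ≠ 0)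
    {η ζ : Fin 3 → ℂ} (hb : ∀ i, Y.base (σ i) = P + ω * η i)
    (hp : ∀ i, Y.platform (σ i) = P + ω * ζ i)
    (h : ∀ i, (η i).re * (ζ i).im = (η i).im * (ζ i).re) :
    1 ≤ flexionOrder Y ∧ (2 ≤ flexionOrder Y ↔
      (Matrix.of fun i => ![(η i).re * (ζ i).re + (η i).im * (ζ i).im,
        (ζ i - η i).re, (ζ i - η i).im]).det = 0) := by
  have hL := hasLeadingTerms_of_concurrent Y P fun i => by
    obtain ⟨i, rfl⟩ := σ.surjective i
    rw [hb, hp]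
    simp
    linear_combination (ω.re ^ 2 + ω.im ^ 2) * h i
  have hM : IsUnit (Matrix.det !![1, 0, 0, 0; 0, 1, 0, 0; 0, (P.re : ℂ), 1, 0;
      0, (P.im : ℂ), 0, 1]) := by
    rw [Matrix.det_succ_row_zero]
    simp [Fin.sum_univ_succ, Matrix.det_fin_three, Fin.succAbove]
  refine ⟨one_le_flexionOrder_iff.2 (hL.two_le hM), two_le_flexionOrder_iff.trans ?_⟩
  rw [hL.three_le_iff hM, det_leading_terms_of_concurrent, Complex.ofReal_eq_zero,
    mul_eq_zero_iff_left (by norm_num), ← det_of_perm_eq_zero_iff σ]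
  have hpos := (normSq_pos' hω).ne'
  -- Multiplication by `ω` scales the inner products by `|ω|²`, and the determinant in the two
  -- difference columns by another `|ω|²`.
  rw [← mul_eq_zero_iff_left (pow_ne_zero 2 hpos) (b := Matrix.det (Matrix.of fun i =>
    ![(η i).re * (ζ i).re + (η i).im * (ζ i).im, (ζ i - η i).re, (ζ i - η i).im]))]
  refine Eq.congr_left ?_
  simp [hb, hp, Matrix.det_fin_three]
  ring

/-- The flexion order of a configuration with parallel legs. -/
theorem flexionOrder_of_parallel {Y : Config} {σ : Equiv.Perm (Fin 3)} {P ω : ℂ} (hω : ω ≠ 0)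
    {η : Fin 3 → ℂ} {k : Fin 3 → ℝ} (hb : ∀ i, Y.base (σ i) = P + ω * η i)
    (hp : ∀ i, Y.platform (σ i) = P + ω * (η i + Complex.I * k i)) :
    1 ≤ flexionOrder Y ∧ (2 ≤ flexionOrder Y ↔
      (Matrix.of fun i => ![k i * (η i).re, k i, 1]).det = 0) := by
  have hL := hasLeadingTerms_of_parallel Y ω (k ∘ σ.symm) fun i => by
    obtain ⟨i, rfl⟩ := σ.surjective i
    rw [hb, hp, Function.comp_apply, σ.symm_apply_apply]
    ring
  have hpos := (normSq_pos' hω).ne'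
  have hM : IsUnit (Matrix.det !![1, 0, 0, 0; 0, 0, 1, 0; 0, (-ω.im : ℂ), 0, (-ω.re : ℂ);
      0, (ω.re : ℂ), 0, (-ω.im : ℂ)]) := by
    rw [Matrix.det_succ_row_zero]
    simp [Fin.sum_univ_succ, Matrix.det_fin_three, Fin.succAbove]
    intro e
    apply hpos
    have : ((ω.re ^ 2 + ω.im ^ 2 : ℝ) : ℂ) = 0 := by push_cast; linear_combination -e
    exact_mod_cast this
  refine ⟨one_le_flexionOrder_iff.2 (hL.two_le hM), two_le_flexionOrder_iff.trans ?_⟩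
  rw [hL.three_le_iff hM, det_leading_terms_of_parallel, Complex.ofReal_eq_zero,
    mul_eq_zero_iff_left (mul_ne_zero (by norm_num) (pow_ne_zero 2 hpos)),
    ← det_of_perm_eq_zero_iff σ]
  -- The moment of a leg about the origin is `|ω|² * k i * (η i).re` plus a multiple of `k i`
  -- independent of `i`, which a column operation removes.
  rw [← mul_eq_zero_iff_left hpos (b := Matrix.det (Matrix.of fun i =>
    ![k i * (η i).re, k i, 1]))]
  refine Eq.congr_left ?_
  simp [hb, hp, Matrix.det_fin_three]
  ring

open ComplexConjugate

/-! ### The average of a pair in normal form -/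

lemma mk_ne_zero {a b : ℝ} (h : (a, b) ≠ (0, 0)) : (⟨a, b⟩ : ℂ) ≠ 0 := fun e =>
  h (Prod.ext (congrArg Complex.re e) (congrArg Complex.im e))

/-- The rotation with parameters `(q₀ : q₁)` is multiplication by `q / conj q`, `q = q₀ + i q₁`. -/
lemma conj_mul_bgMap {a b : ℝ} (h : (a, b) ≠ (0, 0)) (z : ℂ) :
    conj (⟨a, b⟩ : ℂ) * bgMap a b 0 0 z = ⟨a, b⟩ * z := by
  have := (normSq_pos' (mk_ne_zero h)).ne'
  simp only at this
  apply Complex.ext <;> simp [bgMap] <;> field_simp <;> ring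

lemma bgMap_eq {a b : ℝ} (h : (a, b) ≠ (0, 0)) (z : ℂ) :
    bgMap a b 0 0 z = ⟨a, b⟩ / conj (⟨a, b⟩ : ℂ) * z := by
  have h₀ : conj (⟨a, b⟩ : ℂ) ≠ 0 := (map_ne_zero _).2 (mk_ne_zero h)
  rw [div_mul_eq_mul_div, ← conj_mul_bgMap h, mul_div_cancel_left₀ _ h₀]

/-- Multiplication by `conj e` turns `p` and its image into `conj e * p` and `e * p`, mirror images
in the line of real multiples of `p`. The midpoint becomes `e₀ p` and the normal `-2 e₁ p`. -/
lemma bisectorPoint_rotation {e₀ e₁ : ℝ} (h : (e₀, e₁) ≠ (0, 0)) (p : ℂ) (l : ℝ) :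
    conj (⟨e₀, e₁⟩ : ℂ) * bisectorPoint p (bgMap e₀ e₁ 0 0 p) l
      = ((e₀ - 2 * e₁ * l : ℝ) : ℂ) * p := by
  have h₁ := conj_mul_bgMap h p
  set z := bgMap e₀ e₁ 0 0 p
  have h₂ : bisectorPoint p z l = (p + z) / 2 + l * (Complex.I * (z - p)) := by
    rw [bisectorPoint]
    congr 2
    apply Complex.ext <;> simp
  have h₃ : conj (⟨e₀, e₁⟩ : ℂ) = e₀ - Complex.I * e₁ := by
    apply Complex.ext <;> simp
  have h₄ : (⟨e₀, e₁⟩ : ℂ) = e₀ + Complex.I * e₁ := by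
    apply Complex.ext <;> simp
  rw [h₃, h₄] at h₁
  rw [h₂, h₃]
  push_cast
  linear_combination (1 / 2 + l * Complex.I) * h₁ + 2 * (l : ℂ) * e₁ * p * Complex.I_mul_I

/-- If the platforms in a normal form differ by a rotation about the origin, the legs of the average
are concurrent, and their anchor points are given by these formulas. -/
theorem flexionOrder_average_of_rotation {X X' : Config} {e₀ e₁ f₀ f₁ : ℝ} {x p : Fin 3 → ℂ}
    (he : (e₀, e₁) ≠ (0, 0))
    (hN : HasNormalForm X X' f₀ f₁ x p fun i => bgMap e₀ e₁ 0 0 (p i)) {ξ : Fin 3 → ℂ}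
    (hξ : ∀ i, conj (⟨e₀, e₁⟩ : ℂ) * x i = ξ i)
    (h : ∀ i, (ξ i).re * (p i).im = (ξ i).im * (p i).re) :
    1 ≤ flexionOrder (average X X') ∧ (2 ≤ flexionOrder (average X X') ↔
      f₀ * (f₀ * e₀ + f₁ * e₁) * (Matrix.of fun i =>
        ![(ξ i).re * (p i).re + (ξ i).im * (p i).im,
          (f₀ * e₀ + f₁ * e₁) * (p i).re - f₀ * (ξ i).re,
          (f₀ * e₀ + f₁ * e₁) * (p i).im - f₀ * (ξ i).im]).det = 0) := by
  obtain ⟨hf, σ, c, t, t', hc, hb, hp, hb', hp'⟩ := hN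
  set e : ℂ := ⟨e₀, e₁⟩
  set f : ℂ := ⟨f₀, f₁⟩
  have hec : conj e ≠ 0 := (map_ne_zero _).2 (mk_ne_zero he)
  have hfc : conj f ≠ 0 := (map_ne_zero _).2 (mk_ne_zero hf)
  have h₁ : f + conj f = 2 * f₀ := by apply Complex.ext <;> simp [f]; ring
  have h₂ : f * conj e + e * conj f = 2 * (f₀ * e₀ + f₁ * e₁) := by
    apply Complex.ext <;> simp [e, f] <;> ring
  -- `P` is the origin of the averaged frame, and `ω` clears the denominators of both rotations.
  -- What remains are the real factors `(f + conj f) / 2 = f₀` and `(f * conj e + e * conj f) / 2 =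
  -- f₀ e₀ + f₁ e₁`.
  have key := flexionOrder_of_concurrent (Y := average X X') (σ := σ) (P := -(t + t') / (2 * c))
    (ω := 1 / (c * conj e * conj f))
    (one_div_ne_zero (mul_ne_zero (mul_ne_zero hc hec) hfc))
    (η := fun i => f₀ * ξ i) (ζ := fun i => (f₀ * e₀ + f₁ * e₁ : ℝ) * p i)
    (fun i => by
      have a₁ := conj_mul_bgMap hf (x i)
      rw [← hb i] at a₁
      rw [← hb' i] at a₁
      simp only [average, ← hξ, ← hb']
      field_simp
      linear_combination a₁ + (c * X'.base (σ i) + t') * h₁)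
    (fun i => by
      have a₁ := conj_mul_bgMap hf (p i)
      have a₂ := conj_mul_bgMap he (p i)
      rw [← hp i] at a₁
      rw [← show _ = bgMap e₀ e₁ 0 0 (p i) from hp' i] at a₂
      simp only [average]
      push_cast
      field_simp
      linear_combination conj e * a₁ + conj f * a₂ + p i * h₂)
    (fun i => by
      simp
      linear_combination f₀ * (f₀ * e₀ + f₁ * e₁) * h i)
  refine ⟨key.1, key.2.trans (Eq.congr_left ?_)⟩
  simp [Matrix.det_fin_three]
  ring

lemma ne_of_snd_ne_zero {e₀ e₁ : ℝ} (he : e₁ ≠ 0) : (e₀, e₁) ≠ (0, 0) := fun h =>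
  he (congrArg Prod.snd h)

/-! ### The determinant in each of the four normal forms. -/

lemma flexionOrder_of_caseI_i {X X' : Config} {e₀ e₁ f₀ f₁ a₅ b₅ a₆ b₆ l₁ l₂ l₃ : ℝ}
    (h : CaseI_i X X' e₀ e₁ f₀ f₁ a₅ b₅ a₆ b₆ l₁ l₂ l₃) :
    1 ≤ flexionOrder (average X X') ∧ (2 ≤ flexionOrder (average X X') ↔
      f₀ * (f₀ * e₀ + f₁ * e₁) * polyI_i e₀ e₁ f₀ f₁ a₅ b₅ a₆ b₆ l₁ l₂ l₃ = 0) := by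
  obtain ⟨he₁, -, -, hN⟩ := h
  have he := ne_of_snd_ne_zero (e₀ := e₀) he₁
  have key := flexionOrder_average_of_rotation he hN
    (ξ := ![((e₀ - 2 * e₁ * l₁ : ℝ) : ℂ) * ⟨0, 1⟩, ((e₀ - 2 * e₁ * l₂ : ℝ) : ℂ) * ⟨a₅, b₅⟩,
      ((e₀ - 2 * e₁ * l₃ : ℝ) : ℂ) * ⟨a₆, b₆⟩])
    (fun i => by fin_cases i <;> exact bisectorPoint_rotation he _ _)
    (fun i => by fin_cases i <;> simp <;> ring)
  refine ⟨key.1, key.2.trans ?_⟩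
  -- The difference columns have entries with the factor `f₀ e₀ + f₁ e₁ - f₀ (e₀ - 2 e₁ l) = e₁ (f₁
  -- + 2 l f₀)`, so each contributes one `e₁`.
  rw [← mul_eq_zero_iff_left (pow_ne_zero 2 he₁)
    (b := f₀ * (f₀ * e₀ + f₁ * e₁) * polyI_i e₀ e₁ f₀ f₁ a₅ b₅ a₆ b₆ l₁ l₂ l₃)]
  refine Eq.congr_left ?_
  simp [Matrix.det_fin_three, polyI_i]
  ring

lemma flexionOrder_of_caseI_ii {X X' : Config} {e₀ e₁ f₀ f₁ a₃ b₃ a₅ b₅ l₁ l₂ : ℝ}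
    (h : CaseI_ii X X' e₀ e₁ f₀ f₁ a₃ b₃ a₅ b₅ l₁ l₂) :
    1 ≤ flexionOrder (average X X') ∧ (2 ≤ flexionOrder (average X X') ↔
      f₀ * (f₀ * e₀ + f₁ * e₁) * polyI_ii e₀ e₁ f₀ f₁ a₃ b₃ a₅ b₅ l₁ l₂ = 0) := by
  obtain ⟨he₁, -, hN⟩ := h
  have he := ne_of_snd_ne_zero (e₀ := e₀) he₁
  have key := flexionOrder_average_of_rotation he hN
    (ξ := ![((e₀ - 2 * e₁ * l₁ : ℝ) : ℂ) * ⟨0, 1⟩, ((e₀ - 2 * e₁ * l₂ : ℝ) : ℂ) * ⟨a₅, b₅⟩,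
      conj (⟨e₀, e₁⟩ : ℂ) * ⟨a₃, b₃⟩])
    (fun i => by
      fin_cases i
      exacts [bisectorPoint_rotation he _ _, bisectorPoint_rotation he _ _, rfl])
    (fun i => by fin_cases i <;> simp; ring)
  refine ⟨key.1, key.2.trans ?_⟩
  by_cases hf₀ : f₀ = 0
  · simp [hf₀]
  -- The row of the fixed platform point contributes `-f₀`, and a row of a bisector point
  -- contributes `e₁`.
  rw [← mul_eq_zero_iff_left (mul_ne_zero (neg_ne_zero.2 hf₀) he₁)
    (b := f₀ * (f₀ * e₀ + f₁ * e₁) * polyI_ii e₀ e₁ f₀ f₁ a₃ b₃ a₅ b₅ l₁ l₂)]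
  refine Eq.congr_left ?_
  simp [Matrix.det_fin_three, polyI_ii]
  ring

lemma flexionOrder_of_caseI_iii {X X' : Config} {e₀ e₁ f₀ f₁ a₂ b₂ a₃ b₃ l₁ : ℝ}
    (h : CaseI_iii X X' e₀ e₁ f₀ f₁ a₂ b₂ a₃ b₃ l₁) :
    1 ≤ flexionOrder (average X X') ∧ (2 ≤ flexionOrder (average X X') ↔
      f₀ * (e₀ * f₀ + e₁ * f₁) * (a₂ * b₃ - a₃ * b₂) * (e₀ - 2 * e₁ * l₁) = 0) := by
  obtain ⟨he₁, hN⟩ := h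
  have he := ne_of_snd_ne_zero (e₀ := e₀) he₁
  have key := flexionOrder_average_of_rotation he hN
    (ξ := ![((e₀ - 2 * e₁ * l₁ : ℝ) : ℂ) * ⟨0, 1⟩, conj (⟨e₀, e₁⟩ : ℂ) * ⟨a₂, b₂⟩,
      conj (⟨e₀, e₁⟩ : ℂ) * ⟨a₃, b₃⟩])
    (fun i => by
      fin_cases i
      exacts [bisectorPoint_rotation he _ _, rfl, rfl])
    (fun i => by fin_cases i <;> simp)
  refine ⟨key.1, key.2.trans ?_⟩
  by_cases hf₀ : f₀ = 0
  · simp [hf₀]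
  have hpos := (normSq_pos' (mk_ne_zero he)).ne'
  simp only at hpos
  -- Both rows of the fixed platform points contribute `-f₀`; the factor `e₀² + e₁²` comes from
  -- multiplying the two base points by `conj e`.
  rw [← mul_eq_zero_iff_left (mul_ne_zero (pow_ne_zero 2 hf₀) hpos)
    (b := f₀ * (e₀ * f₀ + e₁ * f₁) * (a₂ * b₃ - a₃ * b₂) * (e₀ - 2 * e₁ * l₁))]
  refine Eq.congr_left ?_
  simp [Matrix.det_fin_three]
  ring

lemma flexionOrder_of_caseII {X X' : Config} {f₀ f₁ a₅ b₅ a₆ b₆ l₁ l₂ l₃ : ℝ}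
    (h : CaseII X X' f₀ f₁ a₅ b₅ a₆ b₆ l₁ l₂ l₃) :
    1 ≤ flexionOrder (average X X') ∧ (2 ≤ flexionOrder (average X X') ↔
      f₀ * polyII f₀ f₁ a₅ a₆ l₁ l₂ l₃ = 0) := by
  obtain ⟨hf, σ, c, t, t', hc, hb, hp, hb', hp'⟩ := h
  set p : Fin 3 → ℂ := ![0, ⟨a₅, b₅⟩, ⟨a₆, b₆⟩] with hpdef
  set l : Fin 3 → ℝ := ![l₁, l₂, l₃] with hl
  set x : Fin 3 → ℂ := fun i => p i + 1 / 2 + l i * Complex.I with hx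
  set f : ℂ := ⟨f₀, f₁⟩
  have hbg : ∀ z, bgMap 1 0 0 (1 / 2) z = z + 1 := fun z => by
    apply Complex.ext <;> simp [bgMap]
  have hbis : ∀ z k, bisectorPoint z (bgMap 1 0 0 (1 / 2) z) k = z + 1 / 2 + k * Complex.I :=
    fun z k => by
      rw [hbg, bisectorPoint]
      apply Complex.ext <;> simp; ring
  have hx' : ∀ i, c * X'.base (σ i) + t' = x i := fun i => by
    rw [hb' i]
    fin_cases i <;> exact hbis _ _
  have hxb : ∀ i, c * X.base (σ i) + t = bgMap f₀ f₁ 0 0 (x i) := fun i => by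
    rw [hb i, ← hx' i, hb' i]
  have hfc : conj f ≠ 0 := (map_ne_zero _).2 (mk_ne_zero hf)
  have h₁ : conj f = f₀ - Complex.I * f₁ := by apply Complex.ext <;> simp [f]
  have h₂ : f = f₀ + Complex.I * f₁ := by apply Complex.ext <;> simp [f]
  -- Relative to `ω`, the averaged leg is `f₀ p + conj f / 2 - f₀ x`; its real part cancels and its
  -- imaginary part is this `k`.
  have key := flexionOrder_of_parallel (Y := average X X') (σ := σ) (P := -(t + t') / (2 * c))
    (ω := 1 / (c * conj f)) (one_div_ne_zero (mul_ne_zero hc hfc)) (η := fun i => f₀ * x i)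
    (k := fun i => -(f₁ + 2 * l i * f₀) / 2)
    (fun i => by
      have a₁ := conj_mul_bgMap hf (x i)
      rw [← hxb i] at a₁
      have a₂ := hx' i
      simp only [average]
      field_simp
      linear_combination a₁ + conj f * a₂ + x i * (h₁ + h₂))
    (fun i => by
      have a₁ := conj_mul_bgMap hf (p i)
      rw [← hp i] at a₁
      have a₂ := (hp' i).trans (hbg _)
      simp only [average]
      push_cast
      field_simp
      simp only [hx]
      linear_combination a₁ + conj f * a₂ + (p i + 1) * h₁ + p i * h₂)
  refine ⟨key.1, key.2.trans ?_⟩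
  by_cases hf₀ : f₀ = 0
  · simp [Matrix.det_fin_three, hf₀]
  rw [← mul_eq_zero_iff_left (div_ne_zero (neg_ne_zero.2 hf₀) (two_ne_zero' ℝ)) (b := f₀ * polyII f₀ f₁ a₅ a₆ l₁ l₂ l₃)]
  refine Eq.congr_left ?_
  simp [Matrix.det_fin_three, polyII, hx, hl, hpdef]
  ring

/-! ### Existence of a normal form -/

/-- The parameters are half-angle coordinates: a square root `w` of `u` is unimodular, so `w / conj
w = w ^ 2 = u`. -/
lemma exists_bgMap_eq {u : ℂ} (hu : ‖u‖ = 1) :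
    ∃ a b : ℝ, (a, b) ≠ (0, 0) ∧ ∀ z, bgMap a b 0 0 z = u * z := by
  obtain ⟨w, hw⟩ := IsAlgClosed.exists_pow_nat_eq u (n := 2) (by norm_num)
  have hw₁ : ‖w‖ = 1 := by
    have : ‖w‖ ^ 2 = 1 := by rw [← norm_pow, hw, hu]
    exact (pow_eq_one_iff_of_nonneg (norm_nonneg w) two_ne_zero).1 this
  have hw₀ : w ≠ 0 := norm_ne_zero_iff.1 (by rw [hw₁]; exact one_ne_zero)
  have h₀ : (w.re, w.im) ≠ (0, 0) := fun h =>
    hw₀ (Complex.ext (congrArg Prod.fst h) (congrArg Prod.snd h))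
  refine ⟨w.re, w.im, h₀, fun z => ?_⟩
  rw [bgMap_eq h₀]
  have : w * conj w = 1 := by rw [Complex.mul_conj']; simp [hw₁]
  have hc : conj w ≠ 0 := (map_ne_zero _).2 hw₀
  change w / conj w * z = u * z
  congr 1
  rw [← hw]
  field_simp
  linear_combination -this

lemma exists_eq_bisectorPoint {x p p' : ℂ} (hp : p ≠ p') (h : dist x p = dist x p') :
    ∃ l, x = bisectorPoint p p' l := by
  have hd := normSq_pos' (sub_ne_zero.2 hp)
  have h₂ : dist x p ^ 2 = dist x p' ^ 2 := by rw [h]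
  rw [dist_sq_eq, dist_sq_eq] at h₂
  simp only [Complex.sub_re, Complex.sub_im] at hd
  obtain ⟨l, hl⟩ : ∃ l : ℝ, l * ((p.re - p'.re) ^ 2 + (p.im - p'.im) ^ 2)
      = (x.re - (p.re + p'.re) / 2) * (p.im - p'.im)
        + (x.im - (p.im + p'.im) / 2) * (p'.re - p.re) :=
    ⟨_, div_mul_cancel₀ _ hd.ne'⟩
  refine ⟨l, Complex.ext ?_ ?_⟩
  · simp [bisectorPoint]
    refine mul_left_cancel₀ hd.ne' ?_
    linear_combination (p'.re - p.re) / 2 * h₂ - (p.im - p'.im) * hl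
  · simp [bisectorPoint]
    refine mul_left_cancel₀ hd.ne' ?_
    linear_combination (p'.im - p.im) / 2 * h₂ - (p'.re - p.re) * hl

/-- The motion `z ↦ u z + v` places both realisations on one base, and `z ↦ c (z - Q)` normalises
the picture. Rotating by `u⁻¹` gives `X` back its own orientation. -/
lemma hasNormalForm_mk {X X' : Config} {f₀ f₁ : ℝ} {u v c Q : ℂ} {x p p' : Fin 3 → ℂ}
    (hu : u ≠ 0) (hf₀ : (f₀, f₁) ≠ (0, 0)) (hf : ∀ z, bgMap f₀ f₁ 0 0 z = u⁻¹ * z)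
    (hb : ∀ i, u * X.base i + v = X'.base i) (σ : Equiv.Perm (Fin 3)) (hc : c ≠ 0)
    (hx : ∀ i, x i = c * (X'.base (σ i) - Q))
    (hp : ∀ i, p i = c * (u * X.platform (σ i) + v - Q))
    (hp' : ∀ i, p' i = c * (X'.platform (σ i) - Q)) : HasNormalForm X X' f₀ f₁ x p p' := by
  refine ⟨hf₀, σ, c, u⁻¹ * c * (v - Q), -c * Q, hc, fun i => ?_, fun i => ?_, fun i => ?_,
    fun i => ?_⟩
  · rw [hf, hx, ← hb]
    field_simp
    ring
  · rw [hf, hp]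
    field_simp
    ring
  · rw [hx]; ring
  · rw [hp']; ring

/-- Relabels so that the platform points at the rotation centre come last, which leaves exactly the
three rotation cases. -/
lemma exists_perm_sorted {w : Fin 3 → ℂ} (hw : ∃ i, w i ≠ 0) :
    ∃ σ : Equiv.Perm (Fin 3), w (σ 0) ≠ 0 ∧ (w (σ 1) = 0 → w (σ 2) = 0) := by
  obtain ⟨i, hi⟩ := hw
  by_cases h : w (Equiv.swap 0 i 1) = 0
  · refine ⟨(Equiv.swap 1 2).trans (Equiv.swap 0 i), by simpa [Equiv.swap_apply_of_ne_of_ne],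
      fun _ => by simpa⟩
  · exact ⟨Equiv.swap 0 i, by simpa, fun h' => absurd h' h⟩

/-- Every pair of incongruent realisations of Set A has one of the four normal forms. -/
theorem exists_normalForm {X X' : Config} (hnd : X.NonDegenerate) (hsame : SameMetric X X')
    (hinc : Incongruent X X') (hA : SetA X X') :
    (∃ e₀ e₁ f₀ f₁ a₅ b₅ a₆ b₆ l₁ l₂ l₃ : ℝ, CaseI_i X X' e₀ e₁ f₀ f₁ a₅ b₅ a₆ b₆ l₁ l₂ l₃) ∨
    (∃ e₀ e₁ f₀ f₁ a₃ b₃ a₅ b₅ l₁ l₂ : ℝ, CaseI_ii X X' e₀ e₁ f₀ f₁ a₃ b₃ a₅ b₅ l₁ l₂) ∨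
    (∃ e₀ e₁ f₀ f₁ a₂ b₂ a₃ b₃ l₁ : ℝ, CaseI_iii X X' e₀ e₁ f₀ f₁ a₂ b₂ a₃ b₃ l₁) ∨
    (∃ f₀ f₁ a₅ b₅ a₆ b₆ l₁ l₂ l₃ : ℝ, CaseII X X' f₀ f₁ a₅ b₅ a₆ b₆ l₁ l₂ l₃) := by
  obtain ⟨⟨_, ⟨u, v, hu, hg⟩, hb⟩, ⟨_, ⟨u', v', hu', hg'⟩, hp⟩⟩ := hA
  simp only [hg] at hb
  simp only [hg'] at hp
  have hu₀ : u ≠ 0 := norm_ne_zero_iff.1 (by rw [hu]; exact one_ne_zero)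
  obtain ⟨f₀, f₁, hf₀, hf⟩ := exists_bgMap_eq (u := u⁻¹) (by rw [norm_inv, hu, inv_one])
  set ε := u' / u with hε
  have hε₁ : ‖ε‖ = 1 := by rw [hε, norm_div, hu, hu', div_one]
  obtain ⟨e₀, e₁, he₀, he⟩ := exists_bgMap_eq hε₁
  have hP : ∀ i, X'.platform i = ε * (u * X.platform i + v) + (v' - ε * v) := fun i => by
    rw [← hp, hε]
    field_simp
    ring
  -- Equal leg lengths make each base point equidistant from the two positions of its platform
  -- point, hence a point of their bisector.
  have hdist : ∀ i, dist (X'.base i) (u * X.platform i + v)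
      = dist (X'.base i) (X'.platform i) := fun i => by
    rw [← hsame.2.2 i, ← hb, Complex.dist_eq, Complex.dist_eq, add_sub_add_right_eq_sub, ← mul_sub,
      norm_mul, hu, one_mul]
  have hdist' : ∀ (c Q : ℂ) i, dist (c * (X'.base i - Q)) (c * (u * X.platform i + v - Q))
      = dist (c * (X'.base i - Q)) (c * (X'.platform i - Q)) := fun c Q i => by
    have := hdist i
    rw [Complex.dist_eq, Complex.dist_eq] at this ⊢
    rw [← mul_sub, ← mul_sub, norm_mul, norm_mul, sub_sub_sub_cancel_right,
      sub_sub_sub_cancel_right, this]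
  by_cases hε₀ : ε = 1
  · have hrot : ∀ z, rotation ⟨u, mem_sphere_zero_iff_norm.2 hu⟩ z = u * z := fun z =>
      rotation_apply _ _
    -- Were the relative translation also zero, a single direct isometry would carry all of `X` to
    -- `X'`.
    have hκ : v' - v ≠ 0 := fun h => by
      refine hinc ⟨(rotation ⟨u, mem_sphere_zero_iff_norm.2 hu⟩).toIsometryEquiv.trans
        (IsometryEquiv.addRight v), fun i => ?_, fun i => ?_⟩
      · simpa [hrot] using hb i
      · rw [hP i, hε₀]
        simp [hrot]
        linear_combination -h
    set Q := u * X.platform 0 + v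
    set c := (v' - v)⁻¹
    have hc : c ≠ 0 := inv_ne_zero hκ
    have hbg : ∀ z, bgMap 1 0 0 (1 / 2) z = z + 1 := fun z => by
      apply Complex.ext <;> simp [bgMap]
    have hp' : ∀ i, c * (X'.platform i - Q) = c * (u * X.platform i + v - Q) + 1 := fun i => by
      rw [hP, hε₀]
      linear_combination inv_mul_cancel₀ hκ
    have hQ : c * (u * X.platform 0 + v - Q) = 0 := by rw [sub_self, mul_zero]
    have hl : ∀ i, ∃ l, c * (X'.base i - Q) = bisectorPoint (c * (u * X.platform i + v - Q))
        (c * (u * X.platform i + v - Q) + 1) l := fun i => by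
      refine exists_eq_bisectorPoint (by simp) ?_
      rw [hdist', hp']
    choose l hl using hl
    have hl₀ := hl 0
    rw [hQ] at hl₀
    refine Or.inr (Or.inr (Or.inr ⟨f₀, f₁, (c * (u * X.platform 1 + v - Q)).re,
      (c * (u * X.platform 1 + v - Q)).im, (c * (u * X.platform 2 + v - Q)).re,
      (c * (u * X.platform 2 + v - Q)).im, l 0, l 1, l 2,
      hasNormalForm_mk hu₀ hf₀ hf hb 1 hc (Q := Q) (fun i => ?_) (fun i => ?_) (fun i => ?_)⟩))
    · simp only [hbg]
      fin_cases i
      exacts [hl₀.symm, (hl 1).symm, (hl 2).symm]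
    · fin_cases i
      exacts [hQ.symm, rfl, rfl]
    · simp only [hbg, Equiv.Perm.one_apply, hp']
      congr 1
      fin_cases i
      exacts [hQ.symm, rfl, rfl]
  · have hε' : 1 - ε ≠ 0 := sub_ne_zero.2 (Ne.symm hε₀)
    have he₁ : e₁ ≠ 0 := fun h => by
      have h₁ := he 1
      have h₂ : e₀ ≠ 0 := fun h' => he₀ (by rw [h, h'])
      refine hε₀ ?_
      rw [mul_one] at h₁
      rw [← h₁]
      apply Complex.ext <;> simp [bgMap, h, h₂]
    -- The fixed point of the relative rotation `z ↦ ε z + (v' - ε v)`.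
    set Q := (v' - ε * v) / (1 - ε) with hQ
    have hp' : ∀ i, X'.platform i - Q = ε * (u * X.platform i + v - Q) := fun i => by
      rw [hP, hQ]
      field_simp
      ring
    obtain ⟨σ, hσ, hσ'⟩ := exists_perm_sorted (w := fun i => u * X.platform i + v - Q) (by
      by_contra! h
      obtain ⟨i, j, hij⟩ := hnd.2
      exact hij (mul_left_cancel₀ hu₀ (by linear_combination h i - h j)))
    -- Scales and rotates so that the first platform point, seen from the centre, becomes `(0, 1)`.
    set c := Complex.I / (u * X.platform (σ 0) + v - Q)
    have hc : c ≠ 0 := div_ne_zero Complex.I_ne_zero hσ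
    set w : Fin 3 → ℂ := fun i => c * (u * X.platform (σ i) + v - Q) with hw
    have hw₀ : w 0 = ⟨0, 1⟩ := div_mul_cancel₀ _ hσ
    have hne : ∀ i, u * X.platform (σ i) + v - Q ≠ 0 → w i ≠ ε * w i := fun i hi h => by
      have : (1 - ε) * w i = 0 := by linear_combination h
      exact mul_ne_zero hε' (mul_ne_zero hc hi) this
    have hwp : ∀ i, c * (X'.platform (σ i) - Q) = ε * w i := fun i => by rw [hp']; ring
    have hl : ∀ i, ∃ l, u * X.platform (σ i) + v - Q ≠ 0 →
        c * (X'.base (σ i) - Q) = bisectorPoint (w i) (ε * w i) l := fun i => by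
      by_cases hi : u * X.platform (σ i) + v - Q = 0
      · exact ⟨0, fun h => absurd hi h⟩
      · obtain ⟨l, hl⟩ := exists_eq_bisectorPoint (hne i hi) (by rw [hw, hdist', hwp])
        exact ⟨l, fun _ => hl⟩
    choose l hl using hl
    have hl₀ := hl 0 hσ
    rw [hw₀] at hl₀
    by_cases h₁ : u * X.platform (σ 1) + v - Q = 0
    · have h₂ := hσ' h₁
      have hw₁ : w 1 = 0 := by simp only [hw, h₁, mul_zero]
      have hw₂ : w 2 = 0 := by simp only [hw, h₂, mul_zero]
      refine Or.inr (Or.inr (Or.inl ⟨e₀, e₁, f₀, f₁, (c * (X'.base (σ 1) - Q)).re,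
        (c * (X'.base (σ 1) - Q)).im, (c * (X'.base (σ 2) - Q)).re,
        (c * (X'.base (σ 2) - Q)).im, l 0, he₁,
        hasNormalForm_mk hu₀ hf₀ hf hb σ hc (Q := Q) (fun i => ?_) (fun i => ?_) (fun i => ?_)⟩))
      · simp only [he]
        fin_cases i
        exacts [hl₀.symm, rfl, rfl]
      · fin_cases i
        exacts [hw₀.symm, hw₁.symm, hw₂.symm]
      · rw [he, hwp]
        congr 1
        fin_cases i
        exacts [hw₀.symm, hw₁.symm, hw₂.symm]
    · by_cases h₂ : u * X.platform (σ 2) + v - Q = 0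
      · have hw₂ : w 2 = 0 := by simp only [hw, h₂, mul_zero]
        refine Or.inr (Or.inl ⟨e₀, e₁, f₀, f₁, (c * (X'.base (σ 2) - Q)).re,
          (c * (X'.base (σ 2) - Q)).im, (w 1).re, (w 1).im, l 0, l 1, he₁,
          by simp only [he]; exact hne 1 h₁,
          hasNormalForm_mk hu₀ hf₀ hf hb σ hc (Q := Q) (fun i => ?_) (fun i => ?_) (fun i => ?_)⟩)
        · simp only [he]
          fin_cases i
          exacts [hl₀.symm, (hl 1 h₁).symm, rfl]
        · fin_cases i
          exacts [hw₀.symm, rfl, hw₂.symm]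
        · rw [he, hwp]
          congr 1
          fin_cases i
          exacts [hw₀.symm, rfl, hw₂.symm]
      · refine Or.inl ⟨e₀, e₁, f₀, f₁, (w 1).re, (w 1).im, (w 2).re, (w 2).im, l 0, l 1, l 2, he₁,
          by simp only [he]; exact hne 1 h₁, by simp only [he]; exact hne 2 h₂,
          hasNormalForm_mk hu₀ hf₀ hf hb σ hc (Q := Q) (fun i => ?_) (fun i => ?_) (fun i => ?_)⟩
        · simp only [he]
          fin_cases i
          exacts [hl₀.symm, (hl 1 h₁).symm, (hl 2 h₂).symm]
        · fin_cases i
          exacts [hw₀.symm, rfl, rfl]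
        · rw [he, hwp]
          congr 1
          fin_cases i
          exacts [hw₀.symm, rfl, rfl]

end RPR

end

/-! ### Flexion order of averages in Set A. -/

theorem mainTheorem1 (X X' : RPR.Config)
    (hnd : X.NonDegenerate) (hX : X.ProperLegs) (hX' : X'.ProperLegs)
    (hsame : RPR.SameMetric X X') (hinc : RPR.Incongruent X X') (hA : RPR.SetA X X')
    (havg : (RPR.average X X').ProperLegs) :
    1 ≤ RPR.flexionOrder (RPR.average X X') ∧
    ((∃ e₀ e₁ f₀ f₁ a₅ b₅ a₆ b₆ l₁ l₂ l₃ : ℝ,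
        RPR.CaseI_i X X' e₀ e₁ f₀ f₁ a₅ b₅ a₆ b₆ l₁ l₂ l₃) ∨
      (∃ e₀ e₁ f₀ f₁ a₃ b₃ a₅ b₅ l₁ l₂ : ℝ,
        RPR.CaseI_ii X X' e₀ e₁ f₀ f₁ a₃ b₃ a₅ b₅ l₁ l₂) ∨
      (∃ e₀ e₁ f₀ f₁ a₂ b₂ a₃ b₃ l₁ : ℝ,
        RPR.CaseI_iii X X' e₀ e₁ f₀ f₁ a₂ b₂ a₃ b₃ l₁) ∨
      (∃ f₀ f₁ a₅ b₅ a₆ b₆ l₁ l₂ l₃ : ℝ,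
        RPR.CaseII X X' f₀ f₁ a₅ b₅ a₆ b₆ l₁ l₂ l₃)) ∧
    (¬ RPR.IsSingularV1 (RPR.average X X') →
      (∀ e₀ e₁ f₀ f₁ a₅ b₅ a₆ b₆ l₁ l₂ l₃ : ℝ,
        RPR.CaseI_i X X' e₀ e₁ f₀ f₁ a₅ b₅ a₆ b₆ l₁ l₂ l₃ →
        (2 ≤ RPR.flexionOrder (RPR.average X X') ↔
          f₀ * (f₀ * e₀ + f₁ * e₁) * RPR.polyI_i e₀ e₁ f₀ f₁ a₅ b₅ a₆ b₆ l₁ l₂ l₃ = 0)) ∧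
      (∀ e₀ e₁ f₀ f₁ a₃ b₃ a₅ b₅ l₁ l₂ : ℝ,
        RPR.CaseI_ii X X' e₀ e₁ f₀ f₁ a₃ b₃ a₅ b₅ l₁ l₂ →
        (2 ≤ RPR.flexionOrder (RPR.average X X') ↔
          f₀ * (f₀ * e₀ + f₁ * e₁) * RPR.polyI_ii e₀ e₁ f₀ f₁ a₃ b₃ a₅ b₅ l₁ l₂ = 0)) ∧
      (∀ e₀ e₁ f₀ f₁ a₂ b₂ a₃ b₃ l₁ : ℝ,
        RPR.CaseI_iii X X' e₀ e₁ f₀ f₁ a₂ b₂ a₃ b₃ l₁ →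
        (2 ≤ RPR.flexionOrder (RPR.average X X') ↔
          f₀ * (e₀ * f₀ + e₁ * f₁) * (a₂ * b₃ - a₃ * b₂) * (e₀ - 2 * e₁ * l₁) = 0)) ∧
      (∀ f₀ f₁ a₅ b₅ a₆ b₆ l₁ l₂ l₃ : ℝ,
        RPR.CaseII X X' f₀ f₁ a₅ b₅ a₆ b₆ l₁ l₂ l₃ →
        (2 ≤ RPR.flexionOrder (RPR.average X X') ↔
          f₀ * RPR.polyII f₀ f₁ a₅ a₆ l₁ l₂ l₃ = 0))) := by
  have hN := RPR.exists_normalForm hnd hsame hinc hA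
  refine ⟨?_, hN, fun _ => ⟨?_, ?_, ?_, ?_⟩⟩
  · rcases hN with ⟨_, _, _, _, _, _, _, _, _, _, _, h⟩ | ⟨_, _, _, _, _, _, _, _, _, _, h⟩ |
      ⟨_, _, _, _, _, _, _, _, _, h⟩ | ⟨_, _, _, _, _, _, _, _, _, h⟩
    exacts [(RPR.flexionOrder_of_caseI_i h).1, (RPR.flexionOrder_of_caseI_ii h).1,
      (RPR.flexionOrder_of_caseI_iii h).1, (RPR.flexionOrder_of_caseII h).1]
  · intro _ _ _ _ _ _ _ _ _ _ _ h
    exact (RPR.flexionOrder_of_caseI_i h).2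
  · intro _ _ _ _ _ _ _ _ _ _ h
    exact (RPR.flexionOrder_of_caseI_ii h).2
  · intro _ _ _ _ _ _ _ _ _ h
    exact (RPR.flexionOrder_of_caseI_iii h).2
  · intro _ _ _ _ _ _ _ _ _ h
    exact (RPR.flexionOrder_of_caseII h).2
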